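/- Let $G$ be a finite graph (possibly disconnected; loops and parallel edges are allowed) that is embedded in the plane without crossings: the vertices are distinct points, each edge is a simple polygonal arc (a simple closed polygon for a loop) joining its ends, and the interior of an edge contains no vertex and no point of another edge. The faces are the connected components of the complement of the drawing, and a vertex is incident with a face if it lies on the boundary of that face. Suppose that the embedding is an outerplanar map, i.e. every vertex is incident with the unbounded face. The vertex-face incidence poset of $G$ has as elements all vertices and all faces (including the unbounded one), and its only strict relations are $v<f$ where the vertex $v$ is incident with the face $f$. An interval order is a strict order on a set $X$ for which there are real intervals $(a_x,b_x)$, $a_x<b_x$, for $x \in X$, such that $x<y$ if and only if $b_x\le a_y$. The interval dimension of a poset is the minimum number of interval orders whose intersection is the strict order of the poset. Corollary. The vertex-face incidence poset of any outerplanar map has interval dimension at most $3$. -/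

import Mathlib

/-! ### Interval orders and interval dimension -/

/-- A strict order relation `r` is an interval order if each element `x` can be assigned a
nondegenerate real interval `(a x, b x)` such that `x` is below `y` exactly when the interval of `x`
lies entirely to the left of that of `y`. -/
def IsIntervalOrder {X : Type*} (r : X → X → Prop) : Prop :=
  ∃ a b : X → ℝ, (∀ x, a x < b x) ∧ ∀ x y, r x y ↔ b x ≤ a y

/-- The strict order of `X` is the intersection of `t` interval orders. -/
def IsIntersectionOfIntervalOrders (X : Type*) [PartialOrder X] (t : ℕ) : Prop :=
  ∃ I : Fin t → X → X → Prop, (∀ i, IsIntervalOrder (I i)) ∧ ∀ x y, x < y ↔ ∀ i, I i x y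

/-- The interval dimension of a poset: the least number of interval orders whose intersection
is the given order (`⊤` if there is no such number). -/
noncomputable def intervalDimension (X : Type*) [PartialOrder X] : ℕ∞ :=
  ⨅ (t : ℕ) (_ : IsIntersectionOfIntervalOrders X t), (t : ℕ∞)

/-! ### Polygonal arcs and plane maps -/

/-- The Euclidean plane. Only its topology, its affine structure and boundedness are used. -/
abbrev Plane : Type := ℝ × ℝ

/-- A simple polygonal curve with corners `pt 0, …, pt len`: either a simple polygonal arc, or
(if `pt len = pt 0`) a simple closed polygon. The values `pt i` for `i > len` are irrelevant. -/
structure PolygonalCurve where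
  len : ℕ
  pt : ℕ → Plane
  len_pos : 0 < len
  nondegenerate : ∀ i < len, pt i ≠ pt (i + 1)
  /-- Two different segments meet at most in a common corner, and this only if they are consecutive,
  or if they are the first and the last segment of a closed polygon. -/
  simple : ∀ i j, i < j → j < len →
    ∀ x ∈ segment ℝ (pt i) (pt (i + 1)) ∩ segment ℝ (pt j) (pt (j + 1)),
      (j = i + 1 ∧ x = pt j) ∨ (i = 0 ∧ j + 1 = len ∧ pt len = pt 0 ∧ x = pt 0)

namespace PolygonalCurve

/-- The point set of the curve. -/
def carrier (c : PolygonalCurve) : Set Plane :=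
  ⋃ i < c.len, segment ℝ (c.pt i) (c.pt (i + 1))

/-- The curve without its two (possibly equal) end points. -/
def inner (c : PolygonalCurve) : Set Plane :=
  c.carrier \ {c.pt 0, c.pt c.len}

end PolygonalCurve

/-- A (multi)graph with vertex set `V` and edge set `E`, together with a crossing-free drawing of
it in the plane. Loops and parallel edges are allowed, and the graph need not be connected. -/
structure PlaneMap (V E : Type*) where
  /-- the two (possibly equal) ends of an edge -/
  src : E → V
  tgt : E → V
  pos : V → Plane
  curve : E → PolygonalCurve
  pos_injective : Function.Injective pos
  curve_src : ∀ e, (curve e).pt 0 = pos (src e)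
  curve_tgt : ∀ e, (curve e).pt (curve e).len = pos (tgt e)
  /-- The interior of an edge contains no vertex … -/
  pos_notMem_inner : ∀ v e, pos v ∉ (curve e).inner
  /-- … and no point of any other edge. -/
  disjoint_inner : ∀ e e', e ≠ e' → Disjoint (curve e).inner (curve e').carrier

namespace PlaneMap

variable {V E : Type*}

/-- The point set of the drawing. -/
def support (M : PlaneMap V E) : Set Plane :=
  Set.range M.pos ∪ ⋃ e, (M.curve e).carrier

/-- The faces are the connected components of the complement of the drawing. -/
def IsFace (M : PlaneMap V E) (F : Set Plane) : Prop :=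
  ∃ x ∈ M.supportᶜ, F = connectedComponentIn M.supportᶜ x

/-- The type of all faces, including the unbounded one. -/
def Face (M : PlaneMap V E) : Type := {F : Set Plane // M.IsFace F}

/-- A vertex is incident with a face if it lies on the boundary of the face. (Vertices do not lie
in faces, so closure and boundary amount to the same here.) -/
def Incident (M : PlaneMap V E) (v : V) (F : M.Face) : Prop :=
  M.pos v ∈ closure F.1

/-- The map is outerplanar if all vertices are incident with the unbounded face. -/
def IsOuterplanar (M : PlaneMap V E) : Prop :=
  ∃ O : M.Face, ¬ Bornology.IsBounded O.1 ∧ ∀ v, M.Incident v O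

/-- The ground set of the vertex-face incidence poset: all vertices and all faces. -/
inductive VertexFace (M : PlaneMap V E) : Type _
  | vertex (v : V) : VertexFace M
  | face (F : M.Face) : VertexFace M

/-- The strict order of the vertex-face incidence poset: the only strict comparabilities are
`vertex v < face F` for `v` incident with `F`. -/
def VertexFace.Below (M : PlaneMap V E) : M.VertexFace → M.VertexFace → Prop
  | .vertex v, .face F => M.Incident v F
  | _, _ => False

instance (M : PlaneMap V E) : PartialOrder M.VertexFace where
  le x y := x = y ∨ VertexFace.Below M x y
  lt x y := VertexFace.Below M x y
  le_refl x := Or.inl rfl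
  le_trans x y z := by
    rintro (rfl | hxy) (rfl | hyz)
    · exact Or.inl rfl
    · exact Or.inr hyz
    · exact Or.inr hxy
    · cases x <;> cases y <;> cases z <;> simp_all [VertexFace.Below]
  le_antisymm x y := by
    rintro (rfl | hxy) (h | hyx)
    · rfl
    · rfl
    · exact h.symm
    · cases x <;> cases y <;> simp_all [VertexFace.Below]
  lt_iff_le_not_ge x y := by
    cases x <;> cases y <;> simp [VertexFace.Below, eq_comm]

end PlaneMap

/-! Choose a point `p` of the unbounded face `O` and draw in `O` pairwise disjoint piecewise linear
legs from `p` to all vertices. The directions in which the legs leave `p` order the vertices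
linearly. Two other faces `F ≠ G` cannot cross in this order: if `a < b < c < d` with `a, c` on `F`
and `b, d` on `G`, then the legs of `a` and `c`, closed up through `F`, form a closed set whose two
sides at `p` are joined by the legs of `b` and `d` together with `G`, although all these sets are
disjoint (`IsStar.not_crossing`). So the vertex sets of the faces other than `O` form a noncrossing
family.

A vertex `v` off a face `F` is therefore to the right of all vertices of `F`, to the left of all of
them, or strictly between two of them. In the last case `v` has larger depth than every vertex of
`F`, where the depth counts the vertex sets that enclose a vertex without containing it
(`exists_depth`). Position, negated position and depth are thus three functions such that `v`
exceeds all of `F` in at least one. Each function `b` gives an interval order: vertices have right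
ends `b v`, and a face begins at the maximum of `b` over its vertices
(`PlaneMap.isIntersectionOfIntervalOrders`). The face `O` has no vertex off it and needs no
separation.

The topology does not rest on the Jordan curve theorem. What is needed is one direction of
separation, proved with continuous logarithms of `(z - p) / (z - q)`, and the existence of the star.
The latter holds because every component of `O` minus a star has the centre in its closure
(`center_mem_closure`), so that a further leg can always be added. -/

section ComplexPlane

open Complex Topology Filter Set

/-! ### A separation lemma -/

/-- Having such a logarithm is a transitive relation on `D`, since logarithms add. It holds for
nearby points in both directions, because `(z - y) / (z - x)` is then within distance less than 1 of
1 and the principal branch applies. Connectedness of `D` does the rest. -/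
theorem exists_continuousOn_log_div {C D : Set ℂ} (hC : IsClosed C) (hD : IsPreconnected D)
    (h : Disjoint C D) {p q : ℂ} (hp : p ∈ D) (hq : q ∈ D) :
    ∃ L : ℂ → ℂ, ContinuousOn L C ∧ ∀ z ∈ C, exp (L z) = (z - p) / (z - q) := by
  have ne : ∀ x ∈ D, ∀ z ∈ C, z - x ≠ 0 := fun x hx z hz e =>
    h.le_bot ⟨hz, by rw [sub_eq_zero.1 e]; exact hx⟩
  refine hD.induction₂' (fun p q => ∃ L : ℂ → ℂ, ContinuousOn L C ∧
    ∀ z ∈ C, exp (L z) = (z - p) / (z - q)) ?_ ?_ hp hq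
  · intro x hx
    have hx' : x ∈ Cᶜ := fun hxC => h.le_bot ⟨hxC, hx⟩
    obtain ⟨r, hr, hball⟩ := Metric.isOpen_iff.1 hC.isOpen_compl x hx'
    filter_upwards [mem_nhdsWithin_of_mem_nhds (Metric.ball_mem_nhds x hr), self_mem_nhdsWithin]
      with y hy hyD
    have key : ∀ z ∈ C, (z - y) / (z - x) ∈ slitPlane := by
      intro z hz
      have h1 : (z - y) / (z - x) = 1 + (x - y) / (z - x) := by
        field_simp [ne x hx z hz]; ring
      rw [h1]
      apply mem_slitPlane_of_norm_lt_one
      rw [norm_div, div_lt_one (norm_pos_iff.2 (ne x hx z hz))]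
      have h2 : z ∉ Metric.ball x r := fun hzb => hball hzb hz
      rw [Metric.mem_ball, dist_eq_norm] at hy h2
      rw [norm_sub_rev] at hy
      linarith
    have hcont : ContinuousOn (fun z => log ((z - y) / (z - x))) C := by
      refine ContinuousOn.clog ?_ key
      exact ContinuousOn.div (by fun_prop) (by fun_prop) (ne x hx)
    have hexp : ∀ z ∈ C, exp (log ((z - y) / (z - x))) = (z - y) / (z - x) := fun z hz =>
      exp_log (div_ne_zero (ne y hyD z hz) (ne x hx z hz))
    refine ⟨⟨fun z => -log ((z - y) / (z - x)), hcont.neg, fun z hz => ?_⟩, _, hcont, hexp⟩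
    rw [Complex.exp_neg, hexp z hz, inv_div]
  · rintro x y z hx hy hz ⟨L, hL, hL'⟩ ⟨K, hK, hK'⟩
    refine ⟨fun w => L w + K w, hL.add hK, fun w hw => ?_⟩
    rw [Complex.exp_add, hL' w hw, hK' w hw]
    have := ne y hy w hw
    have := ne z hz w hw
    field_simp

/-- Two points on opposite sides of a straight piece of a closed set `C` that stays connected when
a point `m` of this piece is removed cannot be joined in the complement of `C`. -/
theorem not_isPreconnected_of_opposite_sides {C D : Set ℂ} (hC : IsClosed C)
    (hD : IsPreconnected D) (h : Disjoint C D) {m u : ℂ} (hu : u ≠ 0)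
    (hCm : IsPreconnected (C \ {m})) {ε : ℝ} (hε : 0 < ε)
    (hline : ∀ t : ℝ, |t| < ε → m + t * u ∈ C)
    (hcross : ∀ s : ℝ, |s| ≤ 1 → m + s * (I * u) ∈ C → s = 0)
    (hp : m + I * u ∈ D) (hq : m - I * u ∈ D) : False := by
  obtain ⟨L, hL, hL'⟩ := exists_continuousOn_log_div hC hD h hp hq
  -- `g` takes values in `(-∞, 0]` only on the segment between the two points, and this meets `C` in
  -- `m` alone. So the principal `log (g z)` is continuous on `C \ {m}`. It differs from `L` there
  -- by a constant multiple of `2πi`, as `C \ {m}` is connected. But its imaginary part jumps at `m`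
  -- while `L` is continuous there.
  set g : ℂ → ℂ := fun z => (z - (m + I * u)) / (z - (m - I * u)) with hg
  have hIu : I * u ≠ 0 := mul_ne_zero I_ne_zero hu
  have ne : ∀ x ∈ D, ∀ z ∈ C, z - x ≠ 0 := fun x hx z hz e =>
    h.le_bot ⟨hz, by rw [sub_eq_zero.1 e]; exact hx⟩
  have hslit : ∀ z ∈ C \ {m}, g z ∈ slitPlane := by
    rintro z ⟨hz, hzm⟩
    by_contra hns
    rw [mem_slitPlane_iff, not_or, not_lt, not_not] at hns
    set s : ℝ := -(g z).re with hs
    have hs0 : 0 ≤ s := by linarith [hns.1]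
    have hgz : g z = -(s : ℂ) := by
      apply Complex.ext <;> simp [hs, hns.2]
    have h1 : z - (m + I * u) = -(s : ℂ) * (z - (m - I * u)) := by
      rw [← hgz]; simp only [hg]; rw [div_mul_cancel₀ _ (ne _ hq z hz)]
    have hs1 : (1 + s : ℂ) ≠ 0 := by
      have : (1 + s : ℝ) ≠ 0 := by positivity
      exact_mod_cast this
    have h2 : z = m + ((1 - s) / (1 + s) : ℝ) * (I * u) := by
      push_cast
      field_simp
      linear_combination h1
    have h3 := hcross ((1 - s) / (1 + s)) (by
      rw [abs_le]; constructor
      · rw [le_div_iff₀ (by positivity)]; linarith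
      · rw [div_le_iff₀ (by positivity)]; linarith) (by rw [← h2]; exact hz)
    rw [h3] at h2
    exact hzm (by simp [h2])
  have hLog : ContinuousOn (fun z => log (g z)) (C \ {m}) := by
    refine ContinuousOn.clog ?_ hslit
    exact ContinuousOn.div (by fun_prop) (by fun_prop) fun z hz => ne _ hq z hz.1
  set f : ℂ → ℝ := fun z => (L z - log (g z)).im / (2 * Real.pi) with hf
  have hfc : ContinuousOn f (C \ {m}) :=
    (continuous_im.comp_continuousOn ((hL.mono sdiff_subset).sub hLog)).div_const _
  have hfm : MapsTo f (C \ {m}) (range ((↑) : ℤ → ℝ)) := by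
    intro z hz
    have h1 : exp (L z) = exp (log (g z)) := by
      rw [hL' z hz.1, exp_log (slitPlane_ne_zero (hslit z hz))]
    obtain ⟨n, hn⟩ := Complex.exp_eq_exp_iff_exists_int.1 h1
    refine ⟨n, ?_⟩
    have : 2 * Real.pi ≠ 0 := by positivity
    simp only [hf, hn, add_sub_cancel_left]
    rw [eq_div_iff this]
    simp
  have : DiscreteTopology (range ((↑) : ℤ → ℝ)) :=
    Int.isClosedEmbedding_coe_real.isEmbedding.toHomeomorph.symm.isEmbedding.discreteTopology
  obtain ⟨k, -, hk⟩ := hCm.eqOn_const_of_mapsTo ⟨this⟩ hfc hfm ⟨_, 0, rfl⟩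
  have hk' : ∀ z ∈ C \ {m}, (log (g z)).im = (L z).im - 2 * Real.pi * k := by
    intro z hz
    have := hk hz
    simp only [hf, Function.const] at this
    rw [div_eq_iff (by positivity), sub_im] at this
    linarith
  set c : ℝ → ℂ := fun t => m + t * u with hc
  have hcC : ∀ᶠ t in 𝓝 (0 : ℝ), c t ∈ C := by
    filter_upwards [Metric.ball_mem_nhds (0 : ℝ) hε] with t ht
    exact hline t (by simpa using ht)
  have hc0 : c 0 = m := by simp [hc]
  have hcL : Tendsto (fun t => (L (c t)).im) (𝓝 0) (𝓝 (L m).im) := by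
    have h1 : Tendsto c (𝓝 0) (𝓝[C] m) := by
      refine tendsto_nhdsWithin_iff.2 ⟨?_, hcC⟩
      have : Continuous c := by fun_prop
      simpa [hc0] using this.tendsto 0
    have h2 := (hL m (by rw [← hc0]; exact hcC.self_of_nhds)).tendsto.comp h1
    exact (continuous_im.tendsto _).comp h2
  have hgc : ∀ t : ℝ, g (c t) = (t - I) / (t + I) := by
    intro t
    simp only [hg, hc]
    rw [show m + t * u - (m + I * u) = u * (t - I) by ring,
      show m + t * u - (m - I * u) = u * (t + I) by ring, mul_div_mul_left _ _ hu]
  have hne : ∀ t : ℝ, (t : ℂ) + I ≠ 0 := fun t e => by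
    have := congrArg im e
    simp at this
  have him : ∀ t : ℝ, (g (c t)).im = -2 * t / (1 + t ^ 2) := by
    intro t
    have : (1 + t ^ 2 : ℝ) ≠ 0 := by positivity
    rw [hgc, div_im]
    simp [normSq_apply]
    field_simp
    ring
  have hgt : Tendsto (fun t => g (c t)) (𝓝 0) (𝓝 (-1)) := by
    have : Continuous fun t : ℝ => g (c t) := by
      simp only [hgc]
      exact Continuous.div (by fun_prop) (by fun_prop) hne
    have h2 := this.tendsto 0
    rwa [hgc, show ((0 : ℝ) - I : ℂ) / ((0 : ℝ) + I) = -1 by simp] at h2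
  have hcm : ∀ t : ℝ, t ≠ 0 → c t ≠ m := fun t ht e => by simp [hc, ht, hu] at e
  -- Along the line through `m`, `g` passes through `-1` from the upper to the lower half plane, so
  -- the principal argument tends to `π` on the left of `0` and to `-π` on the right.
  have hpos : Tendsto (fun t => (log (g (c t))).im) (𝓝[>] 0) (𝓝 (-Real.pi)) := by
    have h1 : Tendsto (fun t => g (c t)) (𝓝[>] 0) (𝓝[{z | z.im < 0}] (-1)) := by
      refine tendsto_nhdsWithin_iff.2 ⟨hgt.mono_left nhdsWithin_le_nhds, ?_⟩
      filter_upwards [self_mem_nhdsWithin] with t (ht : 0 < t)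
      simp only [him]
      apply div_neg_of_neg_of_pos <;> nlinarith
    have h2 := (tendsto_log_nhdsWithin_im_neg_of_re_neg_of_im_zero (z := -1)
      (by simp) (by simp)).comp h1
    simpa [Function.comp_def] using (continuous_im.tendsto _).comp h2
  have hneg : Tendsto (fun t => (log (g (c t))).im) (𝓝[<] 0) (𝓝 Real.pi) := by
    have h1 : Tendsto (fun t => g (c t)) (𝓝[<] 0) (𝓝[{z | 0 ≤ z.im}] (-1)) := by
      refine tendsto_nhdsWithin_iff.2 ⟨hgt.mono_left nhdsWithin_le_nhds, ?_⟩
      filter_upwards [self_mem_nhdsWithin] with t (ht : t < 0)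
      simp only [him]
      apply div_nonneg <;> nlinarith
    have h2 := (tendsto_log_nhdsWithin_im_nonneg_of_re_neg_of_im_zero (z := -1)
      (by simp) (by simp)).comp h1
    simpa [Function.comp_def] using (continuous_im.tendsto _).comp h2
  have e1 : (L m).im - 2 * Real.pi * k = -Real.pi := by
    refine tendsto_nhds_unique (((hcL.mono_left nhdsWithin_le_nhds).sub_const _).congr' ?_) hpos
    filter_upwards [self_mem_nhdsWithin, mem_nhdsWithin_of_mem_nhds hcC] with t (ht : 0 < t) htC
    exact (hk' _ ⟨htC, hcm t ht.ne'⟩).symm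
  have e2 : (L m).im - 2 * Real.pi * k = Real.pi := by
    refine tendsto_nhds_unique (((hcL.mono_left nhdsWithin_le_nhds).sub_const _).congr' ?_) hneg
    filter_upwards [self_mem_nhdsWithin, mem_nhdsWithin_of_mem_nhds hcC] with t (ht : t < 0) htC
    exact (hk' _ ⟨htC, hcm t ht.ne⟩).symm
  linarith [Real.pi_pos]

/-! ### Circular sectors -/

/-- The open circular sector of radius `r` around `0` between the angles `α` and `β`. -/
def sector (r α β : ℝ) : Set ℂ :=
  (fun x : ℝ × ℝ => (x.1 : ℂ) * exp (x.2 * I)) '' (Ioo 0 r ×ˢ Ioo α β)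

theorem isPreconnected_sector (r α β : ℝ) : IsPreconnected (sector r α β) :=
  (isPreconnected_Ioo.prod isPreconnected_Ioo).image _ (by fun_prop)

theorem mul_exp_mem_sector {r α β ρ θ : ℝ} (hρ : 0 < ρ) (hρr : ρ < r) (hα : α < θ) (hβ : θ < β) :
    (ρ : ℂ) * exp (θ * I) ∈ sector r α β :=
  ⟨(ρ, θ), ⟨⟨hρ, hρr⟩, hα, hβ⟩, rfl⟩

theorem sector_subset_ball (r α β : ℝ) : sector r α β ⊆ Metric.ball 0 r := by
  rintro _ ⟨⟨ρ, θ⟩, ⟨⟨h1, h2⟩, -⟩, rfl⟩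
  simpa [abs_of_pos h1] using h2

theorem mul_exp_mem_closure_sector {r α β ρ θ : ℝ} (hρ : 0 ≤ ρ) (hρr : ρ < r) (hαβ : α < β)
    (hα : α ≤ θ) (hβ : θ ≤ β) : (ρ : ℂ) * exp (θ * I) ∈ closure (sector r α β) := by
  refine image_closure_subset_closure_image (by fun_prop) ⟨(ρ, θ), ?_, rfl⟩
  rw [closure_prod_eq, closure_Ioo (hρ.trans_lt hρr).ne, closure_Ioo hαβ.ne]
  exact ⟨⟨hρ, hρr.le⟩, hα, hβ⟩

theorem smul_eq_mul_exp (s : ℝ) (u : ℂ) : (s : ℂ) * u = (s * ‖u‖ : ℝ) * exp (arg u * I) := by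
  conv_lhs => rw [← norm_mul_exp_arg_mul_I u]
  push_cast; ring

theorem exists_eq_arg_add {ρ θ s : ℝ} {u : ℂ} (hρ : 0 < ρ) (hs : 0 ≤ s)
    (h : (ρ : ℂ) * exp (θ * I) = s * u) : ∃ k : ℤ, θ = arg u + k * (2 * Real.pi) := by
  rw [smul_eq_mul_exp s u] at h
  have hn := congrArg norm h
  rw [norm_mul, norm_mul, norm_exp_ofReal_mul_I, norm_exp_ofReal_mul_I, mul_one, mul_one,
    norm_real, norm_real, Real.norm_of_nonneg hρ.le, Real.norm_of_nonneg (by positivity)] at hn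
  rw [← hn] at h
  have h2 := mul_left_cancel₀ (by exact_mod_cast hρ.ne') h
  obtain ⟨k, hk⟩ := exp_eq_exp_iff_exists_int.1 h2
  refine ⟨k, ?_⟩
  have := congrArg im hk
  simpa using this

/-- A sector avoids a ray if it contains no angle of this ray. -/
theorem mul_notMem_sector {r α β s : ℝ} {u : ℂ} (hs : 0 ≤ s)
    (h : ∀ k : ℤ, α < arg u + k * (2 * Real.pi) → β ≤ arg u + k * (2 * Real.pi)) :
    (s : ℂ) * u ∉ sector r α β := by
  rintro ⟨⟨ρ, θ⟩, ⟨⟨h1, h2⟩, h3, h4⟩, e⟩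
  obtain ⟨k, rfl⟩ := exists_eq_arg_add h1 hs e
  exact absurd (h k h3) (not_le.2 h4)

theorem exists_angle (z : ℂ) (τ : ℝ) : ∃ θ ∈ Ico τ (τ + 2 * Real.pi), ∃ k : ℤ,
    θ = arg z + k * (2 * Real.pi) ∧ ∀ s : ℝ, (s : ℂ) * z = (s * ‖z‖ : ℝ) * exp (θ * I) := by
  obtain ⟨k, hk, -⟩ := existsUnique_add_zsmul_mem_Ico Real.two_pi_pos (arg z) τ
  refine ⟨_, hk, k, by simp, fun s => ?_⟩
  rw [smul_eq_mul_exp]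
  congr 1
  refine exp_eq_exp_iff_exists_int.2 ⟨-k, ?_⟩
  simp
  ring

/-- Excludes that a multiple of `2π` lies strictly between `0` and `2π`; this decides which
representatives of an argument fall into a sector. -/
theorem mul_two_pi_le_or (j : ℤ) :
    (j : ℝ) * (2 * Real.pi) ≤ 0 ∨ 2 * Real.pi ≤ j * (2 * Real.pi) := by
  rcases le_or_gt j 0 with hj | hj
  · have : (j : ℝ) ≤ 0 := by exact_mod_cast hj
    exact .inl (mul_nonpos_of_nonpos_of_nonneg this Real.two_pi_pos.le)
  · have : (1 : ℝ) ≤ j := by exact_mod_cast hj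
    exact .inr (le_mul_of_one_le_left Real.two_pi_pos.le this)

/-- Near a corner, a point off the two rays lies in a connected set that avoids the rays and has
both of them in its closure. -/
theorem exists_sector_of_two_rays {u₁ u₂ y : ℂ} {r : ℝ} (h₁ : u₁ ≠ 0) (h₂ : u₂ ≠ 0)
    (h₁₂ : ∀ s : ℝ, 0 ≤ s → u₂ ≠ s * u₁) (hy : ‖y‖ < r) (hy₁ : ∀ s : ℝ, 0 ≤ s → y ≠ s * u₁)
    (hy₂ : ∀ s : ℝ, 0 ≤ s → y ≠ s * u₂) :
    ∃ N : Set ℂ, IsPreconnected N ∧ y ∈ N ∧ N ⊆ Metric.ball 0 r ∧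
      ∀ u ∈ ({u₁, u₂} : Set ℂ), ∀ s : ℝ, 0 ≤ s →
        (s : ℂ) * u ∉ N ∧ (s * ‖u‖ < r → (s : ℂ) * u ∈ closure N) := by
  have hpi := Real.pi_pos
  obtain ⟨θ, ⟨hθ₁, hθ₂⟩, -, -, hθ⟩ := exists_angle y (arg u₁)
  obtain ⟨τ, ⟨hτ₁, hτ₂⟩, k, hk, hτ⟩ := exists_angle u₂ (arg u₁)
  have hy0 : y ≠ 0 := fun e => hy₁ 0 le_rfl (by simp [e])
  have hyθ : y = (‖y‖ : ℝ) * exp (θ * I) := by simpa using hθ 1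
  have ray : ∀ w : ℂ, w ≠ 0 → ∀ t : ℝ, w = (‖w‖ : ℝ) * exp (t * I) → ∀ u : ℂ, u ≠ 0 → ∀ j : ℝ,
      u = (‖u‖ : ℝ) * exp (j * I) → t = j → ∃ s : ℝ, 0 ≤ s ∧ w = s * u := by
    rintro w hw t hwt u hu j huj rfl
    refine ⟨‖w‖ / ‖u‖, by positivity, ?_⟩
    have : (‖u‖ : ℂ) ≠ 0 := by exact_mod_cast norm_ne_zero_iff.2 hu
    rw [huj, hwt]
    simp only [norm_mul, norm_real, norm_exp_ofReal_mul_I, norm_norm, mul_one]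
    push_cast
    field_simp
  have hu₂ : u₂ = (‖u₂‖ : ℝ) * exp (τ * I) := by simpa using hτ 1
  have hu₁ : u₁ = (‖u₁‖ : ℝ) * exp (arg u₁ * I) := by simp
  have hτ' : arg u₁ < τ := lt_of_le_of_ne hτ₁ fun e => by
    obtain ⟨s, hs, e⟩ := ray u₂ h₂ τ hu₂ u₁ h₁ _ hu₁ e.symm
    exact h₁₂ s hs e
  have hθ' : arg u₁ < θ := lt_of_le_of_ne hθ₁ fun e => by
    obtain ⟨s, hs, e⟩ := ray y hy0 θ hyθ u₁ h₁ _ hu₁ e.symm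
    exact hy₁ s hs e
  have hθτ : θ ≠ τ := fun e => by
    obtain ⟨s, hs, e⟩ := ray y hy0 θ hyθ u₂ h₂ _ hu₂ e
    exact hy₂ s hs e
  have hny : 0 < ‖y‖ := norm_pos_iff.2 hy0
  rcases hθτ.lt_or_gt with hlt | hlt
  · refine ⟨sector r (arg u₁) τ, isPreconnected_sector _ _ _, ?_, sector_subset_ball _ _ _, ?_⟩
    · rw [hyθ]; exact mul_exp_mem_sector hny hy hθ' hlt
    rintro u (rfl | rfl) s hs
    · refine ⟨mul_notMem_sector hs fun j hj => ?_, fun hr => ?_⟩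
      · rcases mul_two_pi_le_or j with h | h <;> linarith
      · rw [smul_eq_mul_exp]
        exact mul_exp_mem_closure_sector (by positivity) hr hτ' le_rfl hτ'.le
    · refine ⟨mul_notMem_sector hs fun j hj => ?_, fun hr => ?_⟩
      · rcases mul_two_pi_le_or (k - j) with h | h <;> push_cast at h <;> linarith
      · rw [hτ]
        exact mul_exp_mem_closure_sector (by positivity) hr hτ' hτ'.le le_rfl
  -- Here `y` lies on the other side of `u₂`; the sector runs on to the ray of `u₁`, now reached at
  -- the angle `arg u₁ + 2π`.
  · refine ⟨sector r τ (arg u₁ + 2 * Real.pi), isPreconnected_sector _ _ _, ?_,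
      sector_subset_ball _ _ _, ?_⟩
    · rw [hyθ]; exact mul_exp_mem_sector hny hy hlt hθ₂
    rintro u (rfl | rfl) s hs
    · refine ⟨mul_notMem_sector hs fun j hj => ?_, fun hr => ?_⟩
      · rcases mul_two_pi_le_or j with h | h <;> linarith
      · have : (s : ℂ) * u = (s * ‖u‖ : ℝ) * exp ((arg u + 2 * Real.pi : ℝ) * I) := by
          rw [smul_eq_mul_exp]
          congr 1
          refine exp_eq_exp_iff_exists_int.2 ⟨-1, ?_⟩
          simp
          ring
        rw [this]
        exact mul_exp_mem_closure_sector (by positivity) hr hτ₂ hτ₂.le le_rfl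
    · refine ⟨mul_notMem_sector hs fun j hj => ?_, fun hr => ?_⟩
      · rcases mul_two_pi_le_or (j - k) with h | h <;> push_cast at h <;> linarith
      · rw [hτ]
        exact mul_exp_mem_closure_sector (by positivity) hr hτ₂ le_rfl hτ₂.le

/-! ### Injective piecewise linear arcs -/

/-- An injective piecewise linear arc, parametrized by `[0, ℓ]`. Piecewise linearity is expressed
locally: on both sides of each parameter value the arc is straight for some time. -/
structure IsPLArc (φ : ℝ → ℂ) (ℓ : ℝ) : Prop where
  pos : 0 < ℓ
  cont : ContinuousOn φ (Icc 0 ℓ)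
  inj : InjOn φ (Icc 0 ℓ)
  right : ∀ t ∈ Ico 0 ℓ, ∃ u : ℂ, ∃ ε > 0, ∀ s ∈ Icc (0 : ℝ) ε, φ (t + s) = φ t + s * u
  left : ∀ t ∈ Ioc 0 ℓ, ∃ u : ℂ, ∃ ε > 0, ∀ s ∈ Icc (0 : ℝ) ε, φ (t - s) = φ t + s * u

/-- A set `F` is accessible from `v` if it contains a straight segment starting at `v`, except
possibly `v` itself. -/
def AccessibleFrom {E : Type*} [AddCommGroup E] [Module ℝ E] (F : Set E) (v : E) : Prop :=
  ∃ q, ∀ t ∈ Ioc (0 : ℝ) 1, v + t • (q - v) ∈ F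

namespace IsPLArc

variable {φ : ℝ → ℂ} {ℓ : ℝ}

theorem restrict (h : IsPLArc φ ℓ) {t : ℝ} (ht : t ∈ Ioc 0 ℓ) : IsPLArc φ t where
  pos := ht.1
  cont := h.cont.mono (Icc_subset_Icc_right ht.2)
  inj := h.inj.mono (Icc_subset_Icc_right ht.2)
  right s hs := h.right s ⟨hs.1, hs.2.trans_le ht.2⟩
  left s hs := h.left s ⟨hs.1, hs.2.trans ht.2⟩

theorem isCompact (h : IsPLArc φ ℓ) : IsCompact (φ '' Icc 0 ℓ) :=
  isCompact_Icc.image_of_continuousOn h.cont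

/-- By compactness, the part of the arc with parameters far from `t` has positive distance from `φ
t`. Hence a small ball sees only the two straight pieces at `t`. -/
theorem exists_ball (h : IsPLArc φ ℓ) {t : ℝ} (ht : t ∈ Icc 0 ℓ) {ε : ℝ} (hε : 0 < ε) :
    ∃ r > 0, ∀ t' ∈ Icc 0 ℓ, φ t' ∈ Metric.ball (φ t) r → |t' - t| < ε := by
  have hK : IsCompact (Icc 0 ℓ ∩ {t' | ε ≤ |t' - t|}) :=
    isCompact_Icc.inter_right (isClosed_le (by fun_prop) (by fun_prop))
  have hK' := (hK.image_of_continuousOn (h.cont.mono inter_subset_left)).isClosed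
  have hn : φ t ∈ (φ '' (Icc 0 ℓ ∩ {t' | ε ≤ |t' - t|}))ᶜ := by
    rintro ⟨t', ⟨h1, h2 : ε ≤ |t' - t|⟩, e⟩
    rw [h.inj h1 ht e] at h2
    simp at h2
    linarith
  obtain ⟨r, hr, hb⟩ := Metric.isOpen_iff.1 hK'.isOpen_compl _ hn
  refine ⟨r, hr, fun t' ht' hm => ?_⟩
  by_contra hc
  exact hb hm ⟨t', ⟨ht', not_lt.1 hc⟩, rfl⟩

/-- Near its start, an arc is a straight ray. -/
theorem ray_at_start (h : IsPLArc φ ℓ) : ∃ u : ℂ, u ≠ 0 ∧ ∃ r > 0,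
    (∀ s : ℝ, 0 ≤ s → s * ‖u‖ < r → s < ℓ ∧ φ s = φ 0 + s * u) ∧
    ∀ t ∈ Icc 0 ℓ, φ t ∈ Metric.ball (φ 0) r → φ t = φ 0 + t * u := by
  obtain ⟨u, ε, hε, hu⟩ := h.right 0 ⟨le_rfl, h.pos⟩
  simp only [zero_add] at hu
  set δ := min ε (ℓ / 2) with hδ
  have hδ0 : 0 < δ := lt_min hε (half_pos h.pos)
  have hδℓ : δ < ℓ := (min_le_right _ _).trans_lt (half_lt_self h.pos)
  have hu0 : u ≠ 0 := by
    rintro rfl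
    have := hu δ ⟨hδ0.le, min_le_left _ _⟩
    rw [mul_zero, add_zero] at this
    exact hδ0.ne' (h.inj ⟨hδ0.le, hδℓ.le⟩ ⟨le_rfl, h.pos.le⟩ this)
  obtain ⟨r, hr, hb⟩ := h.exists_ball ⟨le_rfl, h.pos.le⟩ hδ0
  refine ⟨u, hu0, min r (δ * ‖u‖), lt_min hr (by positivity), fun s hs hsr => ?_, fun t ht hm => ?_⟩
  · have : s < δ := lt_of_mul_lt_mul_right (hsr.trans_le (min_le_right _ _)) (norm_nonneg u)
    exact ⟨this.trans hδℓ, hu s ⟨hs, this.le.trans (min_le_left _ _)⟩⟩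
  · have := hb t ht (Metric.ball_subset_ball (min_le_left _ _) hm)
    rw [sub_zero, abs_of_nonneg ht.1] at this
    exact hu t ⟨ht.1, this.le.trans (min_le_left _ _)⟩

/-- Near an interior point, an arc consists of two different straight rays. -/
theorem rays_at_interior (h : IsPLArc φ ℓ) {t : ℝ} (ht : t ∈ Ioo 0 ℓ) :
    ∃ u₁ u₂ : ℂ, u₁ ≠ 0 ∧ u₂ ≠ 0 ∧ (∀ s : ℝ, 0 ≤ s → u₂ ≠ s * u₁) ∧
    ∃ ε > 0, ε ≤ t ∧ ε ≤ ℓ - t ∧ ∃ r > 0,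
    (∀ s ∈ Icc (0 : ℝ) ε, φ (t - s) = φ t + s * u₁ ∧ φ (t + s) = φ t + s * u₂) ∧
    ∀ t' ∈ Icc 0 ℓ, φ t' ∈ Metric.ball (φ t) r → ∃ s : ℝ, 0 ≤ s ∧
      (φ t' = φ t + s * u₁ ∨ φ t' = φ t + s * u₂) := by
  obtain ⟨u₁, ε₁, hε₁, hu₁⟩ := h.left t ⟨ht.1, ht.2.le⟩
  obtain ⟨u₂, ε₂, hε₂, hu₂⟩ := h.right t ⟨ht.1.le, ht.2⟩
  obtain ⟨δ, hδ0, h1, h2, h3, h4⟩ : ∃ δ > 0, δ ≤ ε₁ ∧ δ ≤ ε₂ ∧ δ ≤ t ∧ δ ≤ ℓ - t :=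
    ⟨min (min ε₁ ε₂) (min t (ℓ - t)), lt_min (lt_min hε₁ hε₂) (lt_min ht.1 (sub_pos.2 ht.2)),
      (min_le_left _ _).trans (min_le_left _ _), (min_le_left _ _).trans (min_le_right _ _),
      (min_le_right _ _).trans (min_le_left _ _), (min_le_right _ _).trans (min_le_right _ _)⟩
  have hφ₁ : ∀ s ∈ Icc (0 : ℝ) δ, φ (t - s) = φ t + s * u₁ := fun s hs =>
    hu₁ s ⟨hs.1, hs.2.trans h1⟩
  have hφ₂ : ∀ s ∈ Icc (0 : ℝ) δ, φ (t + s) = φ t + s * u₂ := fun s hs =>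
    hu₂ s ⟨hs.1, hs.2.trans h2⟩
  have hδ : δ ∈ Icc (0 : ℝ) δ := ⟨hδ0.le, le_rfl⟩
  have htI : t ∈ Icc 0 ℓ := ⟨ht.1.le, ht.2.le⟩
  have hu₁0 : u₁ ≠ 0 := by
    rintro rfl
    have := hφ₁ δ hδ
    rw [mul_zero, add_zero] at this
    have := h.inj ⟨by linarith, by linarith [ht.2]⟩ htI this
    linarith
  have hu₂0 : u₂ ≠ 0 := by
    rintro rfl
    have := hφ₂ δ hδ
    rw [mul_zero, add_zero] at this
    have := h.inj ⟨by linarith [ht.1], by linarith⟩ htI this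
    linarith
  obtain ⟨r, hr, hb⟩ := h.exists_ball htI hδ0
  refine ⟨u₁, u₂, hu₁0, hu₂0, fun s hs e => ?_, δ, hδ0, h3, h4, r, hr,
    fun s hs => ⟨hφ₁ s hs, hφ₂ s hs⟩, fun t' ht' hm => ?_⟩
  -- If both rays had the same direction, the arc would take the same value at `t - s * δ / (s + 1)`
  -- and `t + δ / (s + 1)`; both offsets are at most `δ`.
  · have hs1 : 0 < s + 1 := by linarith
    have hb1 : s * (δ / (s + 1)) ≤ δ := by
      rw [← mul_div_assoc, div_le_iff₀ hs1]; nlinarith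
    have hb2 : δ / (s + 1) ≤ δ := by
      rw [div_le_iff₀ hs1]; nlinarith
    have hb3 : 0 < δ / (s + 1) := by positivity
    have e1 := hφ₁ (s * (δ / (s + 1))) ⟨by positivity, hb1⟩
    have e2 := hφ₂ (δ / (s + 1)) ⟨hb3.le, hb2⟩
    have e3 : φ (t - s * (δ / (s + 1))) = φ (t + δ / (s + 1)) := by
      rw [e1, e2, e]; push_cast; ring
    have hb4 : 0 ≤ s * (δ / (s + 1)) := by positivity
    have := h.inj ⟨by linarith, by linarith [ht.2]⟩ ⟨by linarith [ht.1], by linarith⟩ e3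
    linarith
  · have hlt := abs_lt.1 (hb t' ht' hm)
    rcases le_total t' t with hle | hle
    · refine ⟨t - t', by linarith, .inl ?_⟩
      rw [← hφ₁ (t - t') ⟨by linarith, by linarith⟩]; congr 1; ring
    · refine ⟨t' - t, by linarith, .inr ?_⟩
      rw [← hφ₂ (t' - t) ⟨by linarith, by linarith⟩]; congr 1; ring

/-- An arc can be rerouted to end at the far end of a segment attached to its last point. -/
theorem extend (h : IsPLArc φ ℓ) {z : ℂ} (hz : φ 0 ∉ segment ℝ (φ ℓ) z) :
    ∃ ψ ℓ', IsPLArc ψ ℓ' ∧ ψ 0 = φ 0 ∧ ψ ℓ' = z ∧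
      ∀ t ∈ Ioc 0 ℓ', ψ t ∈ φ '' Ioc 0 ℓ ∪ segment ℝ (φ ℓ) z := by
  have hKc : IsCompact (Icc 0 ℓ ∩ φ ⁻¹' segment ℝ (φ ℓ) z) := by
    refine isCompact_Icc.of_isClosed_subset ?_ inter_subset_left
    refine h.cont.preimage_isClosed_of_isClosed isClosed_Icc ?_
    rw [segment_eq_image_lineMap]
    exact (isCompact_Icc.image (by fun_prop)).isClosed
  -- The arc is cut at its first point on the segment and continued along the segment, so that the
  -- new part meets the old one only at `φ t₀`.
  obtain ⟨t₀, ⟨ht₀, hseg : φ t₀ ∈ segment ℝ (φ ℓ) z⟩, hmin⟩ :=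
    hKc.exists_isLeast ⟨ℓ, ⟨h.pos.le, le_rfl⟩, left_mem_segment ℝ _ _⟩
  have ht₀' : t₀ ∈ Ioc 0 ℓ := ⟨lt_of_le_of_ne ht₀.1 (by rintro rfl; exact hz hseg), ht₀.2⟩
  by_cases hzt : φ t₀ = z
  · exact ⟨φ, t₀, h.restrict ht₀', rfl, hzt,
      fun t ht => .inl ⟨t, ⟨ht.1, ht.2.trans ht₀.2⟩, rfl⟩⟩
  set ψ : ℝ → ℂ := fun t => if t ≤ t₀ then φ t else φ t₀ + ((t - t₀ : ℝ) : ℂ) * (z - φ t₀) with hψ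
  have hψ₁ : ∀ t ≤ t₀, ψ t = φ t := fun t ht => by simp [hψ, ht]
  have hψ₂ : ∀ t ≥ t₀, ψ t = φ t₀ + ((t - t₀ : ℝ) : ℂ) * (z - φ t₀) := fun t ht => by
    rcases ht.eq_or_lt with rfl | hlt
    · simp [hψ]
    · simp [hψ, not_le.2 hlt]
  have hψs : ∀ t ∈ Icc t₀ (t₀ + 1), ψ t ∈ segment ℝ (φ ℓ) z := fun t ht => by
    refine (convex_segment _ _).segment_subset hseg (right_mem_segment ℝ _ _) ?_
    rw [hψ₂ t ht.1, segment_eq_image']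
    exact ⟨t - t₀, ⟨by linarith [ht.1], by linarith [ht.2]⟩, by simp⟩
  have hz0 : z - φ t₀ ≠ 0 := sub_ne_zero.2 (Ne.symm hzt)
  have hne : ∀ t ∈ Icc 0 t₀, ∀ t' ∈ Ioc t₀ (t₀ + 1), ψ t ≠ ψ t' := by
    intro t ht t' ht' e
    have h1 : φ t ∈ segment ℝ (φ ℓ) z := by
      rw [← hψ₁ t ht.2, e]; exact hψs t' ⟨ht'.1.le, ht'.2⟩
    have h2 : t = t₀ := le_antisymm ht.2 (hmin ⟨⟨ht.1, ht.2.trans ht₀.2⟩, h1⟩)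
    rw [h2, hψ₁ _ le_rfl, hψ₂ t' ht'.1.le, left_eq_add, mul_eq_zero, or_iff_left hz0,
      ofReal_eq_zero] at e
    linarith [ht'.1]
  refine ⟨ψ, t₀ + 1, ⟨by linarith [ht₀.1], ?_, ?_, ?_, ?_⟩, hψ₁ 0 ht₀.1, ?_, fun t ht => ?_⟩
  · have hU : Icc 0 (t₀ + 1) = Icc 0 t₀ ∪ Icc t₀ (t₀ + 1) :=
      (Icc_union_Icc_eq_Icc ht₀.1 (by linarith)).symm
    rw [hU]
    refine ContinuousOn.union_of_isClosed ?_ ?_ isClosed_Icc isClosed_Icc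
    · exact (h.cont.mono (Icc_subset_Icc_right ht₀.2)).congr fun t ht => hψ₁ t ht.2
    · refine ContinuousOn.congr (f := fun t => φ t₀ + ((t - t₀ : ℝ) : ℂ) * (z - φ t₀)) ?_
        fun t ht => hψ₂ t ht.1
      fun_prop
  · intro t ht t' ht' e
    rcases le_or_gt t t₀ with h1 | h1 <;> rcases le_or_gt t' t₀ with h2 | h2
    · rw [hψ₁ t h1, hψ₁ t' h2] at e
      exact h.inj ⟨ht.1, h1.trans ht₀.2⟩ ⟨ht'.1, h2.trans ht₀.2⟩ e
    · exact absurd e (hne t ⟨ht.1, h1⟩ t' ⟨h2, ht'.2⟩)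
    · exact absurd e.symm (hne t' ⟨ht'.1, h2⟩ t ⟨h1, ht.2⟩)
    · rw [hψ₂ t h1.le, hψ₂ t' h2.le, add_right_inj, mul_left_inj' hz0, ofReal_inj] at e
      linarith
  · intro t ht
    rcases lt_or_ge t t₀ with h1 | h1
    · obtain ⟨u, ε, hε, hu⟩ := h.right t ⟨ht.1, h1.trans_le ht₀.2⟩
      refine ⟨u, min ε (t₀ - t), lt_min hε (by linarith), fun s hs => ?_⟩
      have := hs.2.trans (min_le_right _ _)
      rw [hψ₁ t h1.le, hψ₁ (t + s) (by linarith), hu s ⟨hs.1, hs.2.trans (min_le_left _ _)⟩]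
    · refine ⟨z - φ t₀, 1, one_pos, fun s hs => ?_⟩
      rw [hψ₂ t h1, hψ₂ (t + s) (by linarith [hs.1])]
      push_cast; ring
  · intro t ht
    rcases le_or_gt t t₀ with h1 | h1
    · obtain ⟨u, ε, hε, hu⟩ := h.left t ⟨ht.1, h1.trans ht₀.2⟩
      refine ⟨u, ε, hε, fun s hs => ?_⟩
      rw [hψ₁ t h1, hψ₁ (t - s) (by linarith [hs.1]), hu s hs]
    · refine ⟨-(z - φ t₀), t - t₀, by linarith, fun s hs => ?_⟩
      rw [hψ₂ t h1.le, hψ₂ (t - s) (by linarith [hs.2])]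
      push_cast; ring
  · rw [hψ₂ _ (by linarith)]; simp
  · rcases le_or_gt t t₀ with h1 | h1
    · exact .inl ⟨t, ⟨ht.1, h1.trans ht₀.2⟩, (hψ₁ t h1).symm⟩
    · exact .inr (hψs t ⟨h1.le, ht.2⟩)

/-- Straight arcs. -/
theorem of_segment {p q : ℂ} (h : p ≠ q) : IsPLArc (fun t => p + t * (q - p)) 1 where
  pos := one_pos
  cont := by fun_prop
  inj t _ t' _ e := by
    simpa [sub_ne_zero.2 h.symm] using e
  right t _ := ⟨q - p, 1, one_pos, fun s _ => by push_cast; ring⟩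
  left t _ := ⟨-(q - p), 1, one_pos, fun s _ => by push_cast; ring⟩

end IsPLArc

theorem segment_subset_of_accessible {F : Set ℂ} {v q : ℂ}
    (h : ∀ t ∈ Ioc (0 : ℝ) 1, v + t • (q - v) ∈ F) {z : ℂ} (hz : z ∈ segment ℝ v q) (hzv : z ≠ v) :
    z ∈ F := by
  rw [segment_eq_image'] at hz
  obtain ⟨t, ht, rfl⟩ := hz
  refine h t ⟨lt_of_le_of_ne ht.1 ?_, ht.2⟩
  rintro rfl
  simp at hzv

/-- Two points from which a connected open set is accessible are joined by an arc through it. -/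
theorem exists_isPLArc {W : Set ℂ} (hW : IsOpen W) (hWc : IsPreconnected W) {p v : ℂ} (hp : p ∉ W)
    (hpv : p ≠ v) (hpW : AccessibleFrom W p) (hvW : AccessibleFrom W v) :
    ∃ φ ℓ, IsPLArc φ ℓ ∧ φ 0 = p ∧ φ ℓ = v ∧ ∀ t ∈ Ioo 0 ℓ, φ t ∈ W := by
  obtain ⟨q, hq⟩ := hpW
  obtain ⟨w, hw⟩ := hvW
  have hqW : q ∈ W := by simpa using hq 1 (by simp)
  have hwW : w ∈ W := by simpa using hw 1 (by simp)
  have reach : ∀ y ∈ W, ∃ φ ℓ, IsPLArc φ ℓ ∧ φ 0 = p ∧ φ ℓ = y ∧ ∀ t ∈ Ioc 0 ℓ, φ t ∈ W := by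
    intro y hy
    -- Reachability is propagated in the form "if `x` is reachable, so is `y`", which is transitive
    -- and, inside a ball in `W`, holds in both directions by `IsPLArc.extend`.
    refine hWc.induction₂' (fun x y => (∃ φ ℓ, IsPLArc φ ℓ ∧ φ 0 = p ∧ φ ℓ = x ∧
      ∀ t ∈ Ioc 0 ℓ, φ t ∈ W) → ∃ φ ℓ, IsPLArc φ ℓ ∧ φ 0 = p ∧ φ ℓ = y ∧ ∀ t ∈ Ioc 0 ℓ, φ t ∈ W)
      ?_ (fun x y z _ _ _ h1 h2 h => h2 (h1 h)) hqW hy ?_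
    · intro x hx
      obtain ⟨r, hr, hb⟩ := Metric.isOpen_iff.1 hW x hx
      have key : ∀ x' y', segment ℝ x' y' ⊆ W → (∃ φ ℓ, IsPLArc φ ℓ ∧ φ 0 = p ∧ φ ℓ = x' ∧
          ∀ t ∈ Ioc 0 ℓ, φ t ∈ W) → ∃ φ ℓ, IsPLArc φ ℓ ∧ φ 0 = p ∧ φ ℓ = y' ∧
          ∀ t ∈ Ioc 0 ℓ, φ t ∈ W := by
        rintro x' y' hs ⟨φ, ℓ, hφ, h0, rfl, hφW⟩
        obtain ⟨ψ, ℓ', hψ, h0', h1, hr⟩ := hφ.extend (z := y') (fun hm => hp (h0 ▸ hs hm))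
        refine ⟨ψ, ℓ', hψ, h0'.trans h0, h1, fun t ht => ?_⟩
        rcases hr t ht with ⟨s, hs, e⟩ | h
        · rw [← e]; exact hφW s hs
        · exact hs h
      filter_upwards [mem_nhdsWithin_of_mem_nhds (Metric.ball_mem_nhds x hr)] with y hy
      have hc := convex_ball x r
      have hx' := Metric.mem_ball_self (x := x) hr
      exact ⟨key _ _ ((hc.segment_subset hx' hy).trans hb),
        key _ _ ((hc.segment_subset hy hx').trans hb)⟩
    · have hpq : p ≠ q := fun e => hp (e ▸ hqW)
      exact ⟨_, 1, .of_segment hpq, by simp, by simp, fun t ht => by simpa using hq t ht⟩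
  obtain ⟨φ, ℓ, hφ, h0, h1, hφW⟩ := reach w hwW
  have hsub : ∀ z ∈ segment ℝ w v, z ≠ v → z ∈ W := fun z hz hzv =>
    segment_subset_of_accessible hw (by rwa [segment_symm]) hzv
  obtain ⟨ψ, ℓ', hψ, h0', h1', hr⟩ := hφ.extend (z := v) (by
    rw [h0, h1]; exact fun hm => hp (hsub p hm hpv))
  refine ⟨ψ, ℓ', hψ, h0'.trans h0, h1', fun t ht => ?_⟩
  rcases hr t ⟨ht.1, ht.2.le⟩ with ⟨s, hs, e⟩ | h
  · rw [← e]; exact hφW s hs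
  · refine hsub _ (h1 ▸ h) fun e => ht.2.ne ?_
    exact hψ.inj ⟨ht.1.le, ht.2.le⟩ ⟨hψ.pos.le, le_rfl⟩ (e.trans h1'.symm)

/-! ### Stars in a connected open set -/

/-- If `A` is locally a cone with apex `v`, a point of the component close to `v` brings the whole
segment towards `v` with it, as this is connected and lies in `A`. -/
theorem accessibleFrom_connectedComponentIn {E : Type*} [NormedAddCommGroup E] [NormedSpace ℝ E]
    {A : Set E} {v x : E} (hA : ∀ᶠ y in 𝓝 v, y ∈ A → ∀ t ∈ Ioc (0 : ℝ) 1, v + t • (y - v) ∈ A)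
    (hv : v ∈ closure (connectedComponentIn A x)) :
    AccessibleFrom (connectedComponentIn A x) v := by
  obtain ⟨q, hq, hqW⟩ := mem_closure_iff_nhds.1 hv _ hA
  refine ⟨q, fun t ht => ?_⟩
  have hpre : IsPreconnected ((fun t : ℝ => v + t • (q - v)) '' Ioc 0 1) :=
    isPreconnected_Ioc.image _ (by fun_prop)
  rw [connectedComponentIn_eq hqW]
  refine hpre.subset_connectedComponentIn ⟨1, by simp, by simp⟩ ?_ ⟨t, ht, rfl⟩
  rintro _ ⟨s, hs, rfl⟩
  exact hq (connectedComponentIn_subset _ _ hqW) s hs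

/-- An arc from `p` to `x` that runs inside `O`, except for its ends. -/
structure IsLeg (O : Set ℂ) (p x : ℂ) (φ : ℝ → ℂ) (ℓ : ℝ) : Prop extends IsPLArc φ ℓ where
  start : φ 0 = p
  finish : φ ℓ = x
  mem : ∀ t ∈ Ioo 0 ℓ, φ t ∈ O

theorem IsLeg.mem_or_eq {O : Set ℂ} {p x : ℂ} {φ : ℝ → ℂ} {ℓ : ℝ} (h : IsLeg O p x φ ℓ) {t : ℝ}
    (ht : t ∈ Ioc 0 ℓ) : φ t ∈ O ∨ φ t = x := by
  rcases ht.2.eq_or_lt with rfl | hlt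
  · exact .inr h.finish
  · exact .inl (h.mem t ⟨ht.1, hlt⟩)

theorem IsLeg.start_notMem {O : Set ℂ} {p x : ℂ} {φ : ℝ → ℂ} {ℓ : ℝ} (h : IsLeg O p x φ ℓ) :
    p ∉ φ '' Ioc 0 ℓ := by
  rintro ⟨t, ht, e⟩
  exact ht.1.ne' (h.inj ⟨ht.1.le, ht.2⟩ ⟨le_rfl, h.pos.le⟩ (e.trans h.start.symm))

section Star

variable {V : Type*} {O : Set ℂ} {p : ℂ} {s : Set V} {pos : V → ℂ} {φ : V → ℝ → ℂ} {ℓ : V → ℝ}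

/-- A star with centre `p` and pairwise disjoint legs to the points `pos v` for `v ∈ s`. -/
structure IsStar (O : Set ℂ) (p : ℂ) (pos : V → ℂ) (s : Set V) (φ : V → ℝ → ℂ) (ℓ : V → ℝ) :
    Prop where
  leg : ∀ v ∈ s, IsLeg O p (pos v) (φ v) (ℓ v)
  disj : ∀ v ∈ s, ∀ w ∈ s, v ≠ w → Disjoint (φ v '' Ioc 0 (ℓ v)) (φ w '' Ioc 0 (ℓ w))

theorem IsStar.mono {s' : Set V} (h : IsStar O p pos s φ ℓ) (hs : s' ⊆ s) :
    IsStar O p pos s' φ ℓ :=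
  ⟨fun v hv => h.leg v (hs hv), fun v hv w hw => h.disj v (hs hv) w (hs hw)⟩

/-- The point set of a star. -/
def starSet (p : ℂ) (s : Set V) (φ : V → ℝ → ℂ) (ℓ : V → ℝ) : Set ℂ :=
  insert p (⋃ v ∈ s, φ v '' Icc 0 (ℓ v))

theorem mem_starSet_iff (h : IsStar O p pos s φ ℓ) {y : ℂ} :
    y ∈ starSet p s φ ℓ ↔ y = p ∨ ∃ v ∈ s, y ∈ φ v '' Ioc 0 (ℓ v) := by
  simp only [starSet, mem_insert_iff, mem_iUnion, exists_prop]
  constructor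
  · rintro (h | ⟨v, hv, t, ht, rfl⟩)
    · exact .inl h
    · rcases ht.1.eq_or_lt with rfl | hlt
      · exact .inl (h.leg v hv).start
      · exact .inr ⟨v, hv, t, ⟨hlt, ht.2⟩, rfl⟩
  · rintro (h | ⟨v, hv, t, ht, rfl⟩)
    · exact .inl h
    · exact .inr ⟨v, hv, t, ⟨ht.1.le, ht.2⟩, rfl⟩

theorem isClosed_starSet [Finite V] (h : IsStar O p pos s φ ℓ) : IsClosed (starSet p s φ ℓ) :=
  (isClosed_singleton (x := p)).union
    (s.toFinite.isClosed_biUnion fun v hv => (h.leg v hv).isCompact.isClosed)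

/-- The centre of a star is in the closure of each component of the complement of the star. -/
theorem center_mem_closure [Finite V] (h : IsStar O p pos s φ ℓ) (hO : IsOpen O)
    (hOc : IsPreconnected O) (hp : p ∈ O) (hpos : ∀ v, pos v ∉ O) {x : ℂ}
    (hx : x ∈ O \ starSet p s φ ℓ) :
    p ∈ closure (connectedComponentIn (O \ starSet p s φ ℓ) x) := by
  set T := starSet p s φ ℓ with hT
  set W := connectedComponentIn (O \ T) x with hW
  have hpT : p ∈ T := (mem_starSet_iff h).2 (.inl rfl)
  have hWsub : W ⊆ O \ T := connectedComponentIn_subset _ _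
  have hxW : x ∈ W := mem_connectedComponentIn hx
  have absorb : ∀ N : Set ℂ, IsPreconnected N → N ⊆ O \ T → (N ∩ W).Nonempty → N ⊆ W := by
    rintro N hN hNs ⟨y, hyN, hyW⟩
    rw [hW, connectedComponentIn_eq hyW]
    exact hN.subset_connectedComponentIn hyN hNs
  -- Otherwise `W` would be relatively closed as well as open in the connected set `O`, hence
  -- contain `p`.
  obtain ⟨y, hyW, hyO, hyT⟩ : ∃ y ∈ closure W, y ∈ O ∧ y ∈ T := by
    by_contra! hc
    have hWo : IsOpen W := (hO.sdiff (isClosed_starSet h)).connectedComponentIn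
    refine (hWsub (hOc.subset_of_closure_inter_subset hWo ⟨x, hx.1, hxW⟩ ?_ hp)).2 hpT
    rintro z ⟨hzW, hzO⟩
    have hz : z ∈ O \ T := ⟨hzO, hc z hzW hzO⟩
    refine absorb (insert z W) ?_ (insert_subset hz hWsub) ⟨x, .inr hxW, hxW⟩ (mem_insert z W)
    exact isPreconnected_connectedComponentIn.subset_closure (subset_insert _ _)
      (insert_subset hzW subset_closure)
  rcases (mem_starSet_iff h).1 hyT with rfl | ⟨v, hv, t, ht, rfl⟩
  · exact hyW
  have hl := h.leg v hv
  have ht' : t ∈ Ioo 0 (ℓ v) := ⟨ht.1, lt_of_le_of_ne ht.2 fun e => hpos v (by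
    rwa [e, hl.finish] at hyO)⟩
  -- The contact of `closure W` with a leg spreads along the whole leg: `J` is open, because a
  -- sector between the two rays at a point of the leg stays in `W` and has both rays in its
  -- closure, and `J` is relatively closed. So contact reaches the parameter `0`, the centre.
  set J : Set ℝ := {t ∈ Ioo 0 (ℓ v) | φ v t ∈ closure W} with hJ
  have hJo : IsOpen J := by
    rw [Metric.isOpen_iff]
    rintro t ⟨ht, htW⟩
    obtain ⟨u₁, u₂, h₁, h₂, h₁₂, ε, hε, hεt, hεℓ, r, hr, hφ, hb⟩ := hl.rays_at_interior ht
    -- The star without the leg of `v` is closed and misses `φ v t`, so in a small ball only this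
    -- leg has to be avoided.
    have h' : IsStar O p pos (s \ {v}) φ ℓ := h.mono sdiff_subset
    have hnot : φ v t ∈ O \ starSet p (s \ {v}) φ ℓ := by
      refine ⟨hl.mem t ht, fun hm => ?_⟩
      have hvt : φ v t ∈ φ v '' Ioc 0 (ℓ v) := ⟨t, ⟨ht.1, ht.2.le⟩, rfl⟩
      rcases (mem_starSet_iff h').1 hm with e | ⟨w, hw, hwt⟩
      · exact hl.start_notMem (e ▸ hvt)
      · exact (h.disj v hv w hw.1 (Ne.symm hw.2)).le_bot ⟨hvt, hwt⟩
    obtain ⟨r', hr', hb'⟩ := Metric.isOpen_iff.1 (hO.sdiff (isClosed_starSet h')) _ hnot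
    have hn₁ : 0 < ‖u₁‖ := norm_pos_iff.2 h₁
    have hn₂ : 0 < ‖u₂‖ := norm_pos_iff.2 h₂
    obtain ⟨R, hR0, hRr, hRr', hR₁, hR₂⟩ :
        ∃ R > 0, R ≤ r ∧ R ≤ r' ∧ R ≤ ε * ‖u₁‖ ∧ R ≤ ε * ‖u₂‖ :=
      ⟨min (min r r') (min (ε * ‖u₁‖) (ε * ‖u₂‖)), by positivity, by simp, by simp, by simp,
        by simp⟩
    obtain ⟨y, hyb, hyW⟩ := mem_closure_iff_nhds.1 htW _ (Metric.ball_mem_nhds _ hR0)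
    have hyT := (hWsub hyW).2
    have hyn : ‖y - φ v t‖ < R := by rwa [← dist_eq_norm]
    have hoff : ∀ t' ∈ Icc 0 (ℓ v), φ v t' ∈ T := fun t' ht' =>
      .inr (mem_biUnion hv ⟨t', ht', rfl⟩)
    have short : ∀ (u : ℂ) (σ : ℝ), 0 < ‖u‖ → R ≤ ε * ‖u‖ → y - φ v t = σ * u → 0 ≤ σ → σ ≤ ε := by
      intro u σ hu hRu e hσ
      rw [e, norm_mul, norm_real, Real.norm_of_nonneg hσ] at hyn
      exact (lt_of_mul_lt_mul_right (hyn.trans_le hRu) hu.le).le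
    obtain ⟨N, hN, hyN, hNb, hNu⟩ := exists_sector_of_two_rays h₁ h₂ h₁₂ hyn
      (fun σ hσ e => hyT (by
        have hσε := short u₁ σ hn₁ hR₁ e hσ
        rw [show y = φ v (t - σ) by rw [(hφ σ ⟨hσ, hσε⟩).1, ← e]; ring]
        exact hoff _ ⟨by linarith, by linarith [ht.2]⟩))
      (fun σ hσ e => hyT (by
        have hσε := short u₂ σ hn₂ hR₂ e hσ
        rw [show y = φ v (t + σ) by rw [(hφ σ ⟨hσ, hσε⟩).2, ← e]; ring]
        exact hoff _ ⟨by linarith [ht.1], by linarith⟩))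
    have hNW : (fun z => φ v t + z) '' N ⊆ W := by
      refine absorb _ (hN.image _ (by fun_prop)) ?_ ⟨y, ⟨_, hyN, by ring⟩, hyW⟩
      rintro _ ⟨z, hz, rfl⟩
      have hzb : φ v t + z ∈ Metric.ball (φ v t) R := by simpa using hNb hz
      obtain ⟨hzO, hzT⟩ := hb' (Metric.ball_subset_ball hRr' hzb)
      refine ⟨hzO, fun hm => hzT ?_⟩
      rw [mem_starSet_iff h']
      rcases (mem_starSet_iff h).1 hm with e | ⟨w, hw, hwz⟩
      · exact .inl e
      by_cases hwv : w = v
      · subst hwv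
        obtain ⟨t', ht', e⟩ := hwz
        obtain ⟨σ, hσ, e' | e'⟩ := hb t' ⟨ht'.1.le, ht'.2⟩
          (e ▸ Metric.ball_subset_ball hRr hzb)
        · rw [e, add_right_inj] at e'
          exact absurd (e' ▸ hz) (hNu u₁ (by simp) σ hσ).1
        · rw [e, add_right_inj] at e'
          exact absurd (e' ▸ hz) (hNu u₂ (by simp) σ hσ).1
      · exact .inr ⟨w, ⟨hw, hwv⟩, hwz⟩
    have hclos : ∀ u ∈ ({u₁, u₂} : Set ℂ), ∀ σ : ℝ, 0 ≤ σ → σ * ‖u‖ < R →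
        φ v t + σ * u ∈ closure W := by
      intro u hu σ hσ hσR
      refine closure_mono hNW (image_closure_subset_closure_image (by fun_prop) ⟨_, ?_, rfl⟩)
      exact (hNu u hu σ hσ).2 hσR
    refine ⟨min (R / ‖u₁‖) (R / ‖u₂‖), by positivity, fun t' ht'' => ?_⟩
    rw [Metric.mem_ball, Real.dist_eq, lt_min_iff, lt_div_iff₀ hn₁, lt_div_iff₀ hn₂] at ht''
    have habs : |t' - t| < ε := lt_of_mul_lt_mul_right (ht''.1.trans_le hR₁) hn₁.le
    have habs' := abs_lt.1 habs
    refine ⟨⟨by linarith, by linarith⟩, ?_⟩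
    rcases le_total t' t with hle | hle
    · have := hclos u₁ (by simp) _ (abs_nonneg _) ht''.1
      rwa [← (hφ _ ⟨abs_nonneg _, habs.le⟩).1, abs_of_nonpos (by linarith),
        show t - -(t' - t) = t' by ring] at this
    · have := hclos u₂ (by simp) _ (abs_nonneg _) ht''.2
      rwa [← (hφ _ ⟨abs_nonneg _, habs.le⟩).2, abs_of_nonneg (by linarith),
        show t + (t' - t) = t' by ring] at this
  have hcont := hl.cont
  have hclosed : IsClosed {t ∈ Icc 0 (ℓ v) | φ v t ∈ closure W} :=
    hcont.preimage_isClosed_of_isClosed isClosed_Icc isClosed_closure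
  have hJsub : closure J ⊆ {t ∈ Icc 0 (ℓ v) | φ v t ∈ closure W} :=
    closure_minimal (fun t ht => ⟨Ioo_subset_Icc_self ht.1, ht.2⟩) hclosed
  have hsub : Ioo 0 (ℓ v) ⊆ J :=
    isPreconnected_Ioo.subset_of_closure_inter_subset hJo ⟨t, ht', ht', hyW⟩
      fun t ht => ⟨ht.2, (hJsub ht.1).2⟩
  have h0 : (0 : ℝ) ∈ closure J := by
    refine closure_mono hsub ?_
    rw [closure_Ioo hl.pos.ne]
    exact ⟨le_rfl, hl.pos.le⟩
  have := (hJsub h0).2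
  rwa [hl.start] at this

/-- Near `p` every leg is a straight ray, so the star is locally a cone with apex `p` and so is its
complement in `O`. -/
theorem accessibleFrom_center [Finite V] (h : IsStar O p pos s φ ℓ) (hO : IsOpen O)
    (hOc : IsPreconnected O) (hp : p ∈ O) (hpos : ∀ v, pos v ∉ O) {x : ℂ}
    (hx : x ∈ O \ starSet p s φ ℓ) :
    AccessibleFrom (connectedComponentIn (O \ starSet p s φ ℓ) x) p := by
  refine accessibleFrom_connectedComponentIn ?_ (center_mem_closure h hO hOc hp hpos hx)
  have hleg : ∀ v ∈ s, ∀ᶠ y in 𝓝 p, ∀ t ∈ Ioc (0 : ℝ) 1,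
      p + t • (y - p) ∈ φ v '' Ioc 0 (ℓ v) → y ∈ φ v '' Ioc 0 (ℓ v) := by
    intro v hv
    have hl := h.leg v hv
    obtain ⟨u, hu, r, hr, h1, h2⟩ := hl.ray_at_start
    rw [hl.start] at h1 h2
    filter_upwards [Metric.ball_mem_nhds p hr] with y hy t ht
    rintro ⟨t', ht', e⟩
    have hb : φ v t' ∈ Metric.ball p r := by
      rw [e]
      have := (convex_ball p r).segment_subset (Metric.mem_ball_self hr) hy
      rw [segment_eq_image'] at this
      exact this ⟨t, ⟨ht.1.le, ht.2⟩, rfl⟩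
    rw [h2 t' ⟨ht'.1.le, ht'.2⟩ hb, add_right_inj, real_smul] at e
    have ht0 : (t : ℂ) ≠ 0 := by exact_mod_cast ht.1.ne'
    have hy' : y = p + ((t' / t : ℝ) : ℂ) * u := by
      push_cast
      field_simp
      linear_combination -e
    have hpos' : 0 < t' / t := div_pos ht'.1 ht.1
    have := h1 (t' / t) hpos'.le (by
      rw [hy', Metric.mem_ball, dist_eq_norm, add_sub_cancel_left, norm_mul, norm_real,
        Real.norm_of_nonneg hpos'.le] at hy
      exact hy)
    exact ⟨t' / t, ⟨hpos', this.1.le⟩, by rw [this.2, hy']⟩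
  obtain ⟨r, hr, hball⟩ := Metric.isOpen_iff.1 hO p hp
  filter_upwards [Metric.ball_mem_nhds p hr, (eventually_all_finite s.toFinite).2 hleg]
    with y hy hys hyA t ht
  refine ⟨hball ?_, fun hm => hyA.2 ?_⟩
  · have := (convex_ball p r).segment_subset (Metric.mem_ball_self hr) hy
    rw [segment_eq_image'] at this
    exact this ⟨t, ⟨ht.1.le, ht.2⟩, rfl⟩
  · rw [mem_starSet_iff h] at hm ⊢
    rcases hm with e | ⟨v, hv, hm⟩
    · rw [add_eq_left, smul_eq_zero, or_iff_right ht.1.ne', sub_eq_zero] at e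
      exact .inl e
    · exact .inr ⟨v, hv, hys v hv t ht hm⟩

/-! ### Growing a star leg by leg -/

theorem AccessibleFrom.sdiff {E : Type*} [NormedAddCommGroup E] [NormedSpace ℝ E] {A T : Set E}
    {v : E} (h : AccessibleFrom A v) (hT : IsClosed T) (hv : v ∉ T) :
    AccessibleFrom (A \ T) v := by
  obtain ⟨q, hq⟩ := h
  have hc : Continuous fun t : ℝ => v + t • (q - v) := by fun_prop
  have : ∀ᶠ t in 𝓝 (0 : ℝ), v + t • (q - v) ∈ Tᶜ :=
    hc.continuousAt.eventually_mem (hT.isOpen_compl.mem_nhds (by simpa using hv))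
  obtain ⟨δ, hδ, hb⟩ := Metric.eventually_nhds_iff.1 this
  set ε := min (δ / 2) 1 with hε
  have hε0 : 0 < ε := by positivity
  refine ⟨v + ε • (q - v), fun t ht => ?_⟩
  rw [add_sub_cancel_left, smul_smul]
  have h1 : 0 < t * ε := mul_pos ht.1 hε0
  have h2 : t * ε ≤ ε := mul_le_of_le_one_left hε0.le ht.2
  refine ⟨hq _ ⟨h1, h2.trans (min_le_right _ _)⟩, hb ?_⟩
  rw [dist_zero_right, Real.norm_of_nonneg h1.le]
  linarith [min_le_left (δ / 2) 1]

theorem AccessibleFrom.exists_component {E : Type*} [NormedAddCommGroup E] [NormedSpace ℝ E]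
    {A : Set E} {v : E} (h : AccessibleFrom A v) :
    ∃ x ∈ A, AccessibleFrom (connectedComponentIn A x) v := by
  obtain ⟨q, hq⟩ := h
  refine ⟨q, by simpa using hq 1 (by simp), q, fun t ht => ?_⟩
  have hpre : IsPreconnected ((fun t : ℝ => v + t • (q - v)) '' Ioc 0 1) :=
    isPreconnected_Ioc.image _ (by fun_prop)
  refine hpre.subset_connectedComponentIn ⟨1, by simp, by simp⟩ ?_ ⟨t, ht, rfl⟩
  rintro _ ⟨s, hs, rfl⟩
  exact hq s hs

/-- The legs are added one at a time. The next vertex is accessible from some component of `O` minus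
the current star; the centre is accessible from the same component, so an arc through it is a new
disjoint leg. -/
theorem exists_isStar [Finite V] (hinj : Function.Injective pos) (hO : IsOpen O)
    (hOc : IsPreconnected O) (hp : p ∈ O) (hpos : ∀ v, pos v ∉ O)
    (hacc : ∀ v, AccessibleFrom O (pos v)) : ∃ φ ℓ, IsStar O p pos univ φ ℓ := by
  classical
  refine Set.Finite.induction_on (motive := fun s _ => ∃ φ ℓ, IsStar O p pos s φ ℓ) univ
    finite_univ ⟨fun _ _ => 0, fun _ => 0, by simp, by simp⟩ ?_
  rintro v s hvs - ⟨φ, ℓ, h⟩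
  have hvT : pos v ∉ starSet p s φ ℓ := fun hm => by
    rcases (mem_starSet_iff h).1 hm with e | ⟨w, hw, t, ht, e⟩
    · exact hpos v (e ▸ hp)
    · rcases (h.leg w hw).mem_or_eq ht with h1 | h1
      · exact hpos v (e ▸ h1)
      · exact hvs (hinj (e.symm.trans h1) ▸ hw)
  obtain ⟨x, hx, hxv⟩ := ((hacc v).sdiff (isClosed_starSet h) hvT).exists_component
  have hWs := connectedComponentIn_subset (O \ starSet p s φ ℓ) x
  have hpT : p ∈ starSet p s φ ℓ := (mem_starSet_iff h).2 (.inl rfl)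
  obtain ⟨ψ, k, hψ, h0, h1, hψW⟩ :=
    exists_isPLArc (v := pos v) (hO.sdiff (isClosed_starSet h)).connectedComponentIn
    isPreconnected_connectedComponentIn (fun hm => (hWs hm).2 hpT) (fun e => hpos v (e ▸ hp))
    (accessibleFrom_center h hO hOc hp hpos hx) hxv
  have hnew : ∀ w ∈ s, Disjoint (ψ '' Ioc 0 k) (φ w '' Ioc 0 (ℓ w)) := by
    intro w hw
    rw [Set.disjoint_left]
    rintro _ ⟨t, ht, rfl⟩ hm
    have hT := (mem_starSet_iff h).2 (.inr ⟨w, hw, hm⟩)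
    rcases ht.2.eq_or_lt with rfl | hlt
    · exact hvT (h1 ▸ hT)
    · exact (hWs (hψW t ⟨ht.1, hlt⟩)).2 hT
  have hne : ∀ w ∈ s, w ≠ v := fun w hw e => hvs (e ▸ hw)
  refine ⟨Function.update φ v ψ, Function.update ℓ v k, ?_, ?_⟩
  · rintro w (rfl | hw)
    · simpa using ⟨hψ, h0, h1, fun t ht => (hWs (hψW t ht)).1⟩
    · simpa [hne w hw] using h.leg w hw
  · rintro w (rfl | hw) w' (rfl | hw') hww'
    · exact absurd rfl hww'
    · simpa [hne w' hw'] using hnew w' hw'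
    · simpa [hne w hw] using (hnew w hw).symm
    · simpa [hne w hw, hne w' hw'] using h.disj w hw w' hw' hww'

end Star

/-! ### The cyclic order around a connected open set -/

theorem exists_isCompact_isPreconnected {F : Set ℂ} (hF : IsOpen F) (hFc : IsPreconnected F)
    {a c : ℂ} (ha : AccessibleFrom F a) (hc : AccessibleFrom F c) :
    ∃ A, IsCompact A ∧ IsPreconnected A ∧ a ∈ A ∧ c ∈ A ∧ A ⊆ F ∪ {a, c} := by
  obtain ⟨q, hq⟩ := ha
  obtain ⟨w, hw⟩ := hc
  have hqF : q ∈ F := by simpa using hq 1 (by simp)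
  have hwF : w ∈ F := by simpa using hw 1 (by simp)
  obtain ⟨γ, hγ⟩ := (hF.isConnected_iff_isPathConnected.1 ⟨⟨q, hqF⟩, hFc⟩).joinedIn q hqF w hwF
  have hcpt : ∀ x y : ℂ, IsCompact (segment ℝ x y) := fun x y => by
    rw [segment_eq_image_lineMap]; exact isCompact_Icc.image (by fun_prop)
  refine ⟨segment ℝ a q ∪ range γ ∪ segment ℝ c w,
    ((hcpt _ _).union (isCompact_range γ.continuous)).union (hcpt _ _), ?_,
    .inl (.inl (left_mem_segment ℝ _ _)), .inr (left_mem_segment ℝ _ _), ?_⟩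
  · refine IsPreconnected.union w (.inr ⟨1, γ.target⟩) (right_mem_segment ℝ _ _) ?_
      (convex_segment _ _).isPreconnected
    exact IsPreconnected.union q (right_mem_segment ℝ _ _) ⟨0, γ.source⟩
      (convex_segment _ _).isPreconnected (isPreconnected_range γ.continuous)
  · rintro z ((hz | ⟨t, rfl⟩) | hz)
    · by_cases h : z = a
      · exact .inr (.inl h)
      · exact .inl (segment_subset_of_accessible hq hz h)
    · exact .inl (hγ t)
    · by_cases h : z = c
      · exact .inr (.inr h)
      · exact .inl (segment_subset_of_accessible hw hz h)

/-- Gives the polar coordinates of a point displaced perpendicularly from a ray, to place it in a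
sector. -/
theorem one_add_mul_I_eq (x : ℝ) :
    (1 : ℂ) + x * I = (Real.sqrt (1 + x ^ 2) : ℝ) * exp (Real.arctan x * I) := by
  have : Real.sqrt (1 + x ^ 2) ≠ 0 := by positivity
  apply Complex.ext
  · rw [re_ofReal_mul, exp_ofReal_mul_I_re, Real.cos_arctan]
    simp [this]
  · rw [im_ofReal_mul, exp_ofReal_mul_I_im, Real.sin_arctan]
    field_simp
    simp

/-- The arc starts in direction `u` and is a straight ray within distance `r` of its start. -/
def HasDirection (φ : ℝ → ℂ) (ℓ : ℝ) (u : ℂ) (r : ℝ) : Prop :=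
  (∀ s : ℝ, 0 ≤ s → s * ‖u‖ < r → s < ℓ ∧ φ s = φ 0 + s * u) ∧
    ∀ t ∈ Icc 0 ℓ, φ t ∈ Metric.ball (φ 0) r → φ t = φ 0 + t * u

/-- Two sets that touch the ends of the legs of a star in a crossing fashion meet. -/
theorem IsStar.not_crossing {V : Type*} {O : Set ℂ} {p : ℂ} {pos : V → ℂ} {φ : V → ℝ → ℂ}
    {ℓ : V → ℝ} (h : IsStar O p pos univ φ ℓ) (hp : p ∈ O)
    (hpos : ∀ v, pos v ∉ O) {u : V → ℂ} (hu : ∀ v, u v ≠ 0) {r : V → ℝ} (hr : ∀ v, 0 < r v)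
    (hdir : ∀ v, HasDirection (φ v) (ℓ v) (u v) (r v)) {F G : Set ℂ} (hF : IsOpen F)
    (hFc : IsPreconnected F) (hGc : IsPreconnected G) (hFO : Disjoint F O) (hGO : Disjoint G O)
    (hFG : Disjoint F G) (hFpos : ∀ v, pos v ∉ F) (hGpos : ∀ v, pos v ∉ G) {a b c d : V}
    (hab : arg (u a) < arg (u b)) (hbc : arg (u b) < arg (u c)) (hcd : arg (u c) < arg (u d))
    (ha : AccessibleFrom F (pos a)) (hc : AccessibleFrom F (pos c)) (hb : pos b ∈ closure G)
    (hd : pos d ∈ closure G) : False := by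
  have hpi := Real.pi_pos
  have lo : ∀ v, -Real.pi < arg (u v) := fun v => neg_pi_lt_arg _
  have hi : ∀ v, arg (u v) ≤ Real.pi := fun v => arg_le_pi _
  have leg := fun v => h.leg v (mem_univ v)
  have ne : ∀ {v w}, arg (u v) < arg (u w) → v ≠ w := fun hlt e => by simp [e] at hlt
  have disj : ∀ {v w}, v ≠ w → ∀ {z}, z ∈ φ v '' Ioc 0 (ℓ v) → z ∉ φ w '' Ioc 0 (ℓ w) :=
    fun hvw _ hz hz' => (h.disj _ (mem_univ _) _ (mem_univ _) hvw).le_bot ⟨hz, hz'⟩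
  have hnear : ∀ v s, 0 ≤ s → s * ‖u v‖ < r v → s < ℓ v ∧ φ v s = p + s * u v := by
    intro v s h1 h2
    simpa [(leg v).start] using (hdir v).1 s h1 h2
  have hball : ∀ v, ∀ t ∈ Icc 0 (ℓ v), φ v t ∈ Metric.ball p (r v) → φ v t = p + t * u v := by
    intro v t h1 h2
    simpa [(leg v).start] using (hdir v).2 t h1 (by simpa [(leg v).start] using h2)
  obtain ⟨A, hAc, hAp, haA, hcA, hAsub⟩ := exists_isCompact_isPreconnected hF hFc ha hc
  have hpA : p ∈ Aᶜ := fun hpA => by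
    rcases hAsub hpA with h1 | h1 | h1
    · exact hFO.le_bot ⟨h1, hp⟩
    · exact hpos a (h1 ▸ hp)
    · exact hpos c (h1 ▸ hp)
  obtain ⟨r₀, hr₀, hA⟩ := Metric.isOpen_iff.1 hAc.isClosed.isOpen_compl p hpA
  obtain ⟨R, hR, hR₀, hRa, hRc⟩ : ∃ R > 0, R ≤ r₀ ∧ R ≤ r a ∧ R ≤ r c :=
    ⟨min r₀ (min (r a) (r c)), lt_min hr₀ (lt_min (hr a) (hr c)), by simp, by simp, by simp⟩
  -- `C` plays the role of a closed curve: out from `p` along the leg of `a`, through `F`, and back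
  -- along the leg of `c`. Only compactness and connectedness of the piece `A` are needed.
  set C : Set ℂ := φ a '' Icc 0 (ℓ a) ∪ φ c '' Icc 0 (ℓ c) ∪ A with hC
  have hCcl : IsClosed C :=
    (((leg a).isCompact.union (leg c).isCompact).union hAc).isClosed
  have hCR : ∀ z, p + z ∈ C → ‖z‖ < R → ∃ s : ℝ, 0 ≤ s ∧ (z = s * u a ∨ z = s * u c) := by
    intro z hz hzR
    have hzb : p + z ∈ Metric.ball p R := by simpa using hzR
    rcases hz with (⟨t, ht, e⟩ | ⟨t, ht, e⟩) | hz
    · refine ⟨t, ht.1, .inl ?_⟩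
      have := hball a t ht (e ▸ Metric.ball_subset_ball hRa hzb)
      rw [e] at this
      exact add_left_cancel this
    · refine ⟨t, ht.1, .inr ?_⟩
      have := hball c t ht (e ▸ Metric.ball_subset_ball hRc hzb)
      rw [e] at this
      exact add_left_cancel this
    · exact absurd hz (hA (Metric.ball_subset_ball hR₀ hzb))
  -- the two sectors cut out by the legs of `a` and `c`
  have hN₁ : ∀ z ∈ sector R (arg (u a)) (arg (u c)), p + z ∉ C := by
    intro z hz hzC
    obtain ⟨s, hs, rfl | rfl⟩ := hCR z hzC (by simpa using sector_subset_ball _ _ _ hz)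
    · refine mul_notMem_sector hs (fun k hk => ?_) hz
      rcases mul_two_pi_le_or k with h1 | h1 <;> linarith [hi c, lo a]
    · refine mul_notMem_sector hs (fun k hk => ?_) hz
      rcases mul_two_pi_le_or (-k) with h1 | h1 <;> push_cast at h1 <;> linarith [hi c, lo a]
  have hN₂ : ∀ z ∈ sector R (arg (u c)) (arg (u a) + 2 * Real.pi), p + z ∉ C := by
    intro z hz hzC
    obtain ⟨s, hs, rfl | rfl⟩ := hCR z hzC (by simpa using sector_subset_ball _ _ _ hz)
    · refine mul_notMem_sector hs (fun k hk => ?_) hz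
      rcases mul_two_pi_le_or k with h1 | h1 <;> linarith
    · refine mul_notMem_sector hs (fun k hk => ?_) hz
      rcases mul_two_pi_le_or k with h1 | h1 <;> linarith
  set N₁ := (fun z => p + z) '' sector R (arg (u a)) (arg (u c)) with hN₁d
  set N₂ := (fun z => p + z) '' sector R (arg (u c)) (arg (u a) + 2 * Real.pi) with hN₂d
  have hN₁p : IsPreconnected N₁ := (isPreconnected_sector _ _ _).image _ (by fun_prop)
  have hN₂p : IsPreconnected N₂ := (isPreconnected_sector _ _ _).image _ (by fun_prop)
  set B := insert (pos b) (insert (pos d) G) with hB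
  have hBp : IsPreconnected B := hGc.subset_closure
    ((subset_insert _ _).trans (subset_insert _ _))
    (insert_subset hb (insert_subset hd subset_closure))
  have hlegp : ∀ v, IsPreconnected (φ v '' Ioc 0 (ℓ v)) := fun v =>
    isPreconnected_Ioc.image _ ((leg v).cont.mono Ioc_subset_Icc_self)
  have hend : ∀ v, pos v ∈ φ v '' Ioc 0 (ℓ v) := fun v =>
    ⟨ℓ v, ⟨(leg v).pos, le_rfl⟩, (leg v).finish⟩
  have hbeg : ∀ v, ∃ ρ : ℝ, 0 < ρ ∧ ρ < R ∧ p + ρ * exp (arg (u v) * I) ∈ φ v '' Ioc 0 (ℓ v) := by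
    intro v
    have hn : 0 < ‖u v‖ := norm_pos_iff.2 (hu v)
    have hm : 0 < min R (r v) := lt_min hR (hr v)
    have e : min R (r v) / 2 / ‖u v‖ * ‖u v‖ = min R (r v) / 2 := by field_simp
    have := hnear v (min R (r v) / 2 / ‖u v‖) (by positivity) (by
      rw [e]; linarith [min_le_right R (r v)])
    refine ⟨min R (r v) / 2, by positivity, by linarith [min_le_left R (r v)],
      _, ⟨by positivity, this.1.le⟩, ?_⟩
    rw [this.2, smul_eq_mul_exp, e]
  -- `D` leads from one side of `C` to the other: from the sector containing the start of the leg of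
  -- `b`, along this leg, through `G`, and back along the leg of `d` into the other sector.
  set D : Set ℂ := N₁ ∪ φ b '' Ioc 0 (ℓ b) ∪ B ∪ φ d '' Ioc 0 (ℓ d) ∪ N₂ with hD
  have hDp : IsPreconnected D := by
    obtain ⟨ρ, h1, h2, h3⟩ := hbeg b
    obtain ⟨ρ', h1', h2', h3'⟩ := hbeg d
    refine IsPreconnected.union _ (.inr h3') ⟨_, mul_exp_mem_sector h1' h2' hcd
      (by linarith [hi d, lo a]), rfl⟩ ?_ hN₂p
    refine IsPreconnected.union (pos d) (.inr (.inr (.inl rfl))) (hend d) ?_ (hlegp d)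
    refine IsPreconnected.union (pos b) (.inr (hend b)) (.inl rfl) ?_ hBp
    exact IsPreconnected.union _ ⟨_, mul_exp_mem_sector h1 h2 hab hbc, rfl⟩ h3 hN₁p (hlegp b)
  have hlegC : ∀ v, v ≠ a → v ≠ c → ∀ z ∈ φ v '' Ioc 0 (ℓ v), z ∉ C := by
    rintro v hva hvc z hz hzC
    have hzp : z ≠ p := fun e => (leg v).start_notMem (e ▸ hz)
    have conv : ∀ w, z ∈ φ w '' Icc 0 (ℓ w) → z ∈ φ w '' Ioc 0 (ℓ w) := by
      rintro w ⟨t, ht, e⟩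
      refine ⟨t, ⟨lt_of_le_of_ne ht.1 ?_, ht.2⟩, e⟩
      rintro rfl
      exact hzp (e.symm.trans (leg w).start)
    rcases hzC with (h1 | h1) | h1
    · exact disj hva hz (conv a h1)
    · exact disj hvc hz (conv c h1)
    · rcases hAsub h1 with h2 | h2 | h2
      · obtain ⟨t, ht, rfl⟩ := hz
        rcases (leg v).mem_or_eq ht with h3 | h3
        · exact hFO.le_bot ⟨h2, h3⟩
        · exact hFpos v (h3 ▸ h2)
      · exact disj hva hz (h2 ▸ hend a)
      · exact disj hvc hz (h2 ▸ hend c)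
  have hGC : ∀ z ∈ G, z ∉ C := by
    intro z hz hzC
    have hzleg : ∀ v, z ∉ φ v '' Icc 0 (ℓ v) := by
      rintro v ⟨t, ht, rfl⟩
      rcases ht.1.eq_or_lt with rfl | h1
      · exact hGO.le_bot ⟨hz, (leg v).start ▸ hp⟩
      · rcases (leg v).mem_or_eq ⟨h1, ht.2⟩ with h3 | h3
        · exact hGO.le_bot ⟨hz, h3⟩
        · exact hGpos v (h3 ▸ hz)
    rcases hzC with (h1 | h1) | h1
    · exact hzleg a h1
    · exact hzleg c h1
    · rcases hAsub h1 with h2 | h2 | h2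
      · exact hFG.le_bot ⟨h2, hz⟩
      · exact hGpos a (h2 ▸ hz)
      · exact hGpos c (h2 ▸ hz)
  have hba := (ne hab).symm
  have hbc' := ne hbc
  have hda := (ne (hab.trans (hbc.trans hcd))).symm
  have hdc := (ne hcd).symm
  have hCD : Disjoint C D := by
    rw [Set.disjoint_right]
    rintro z ((((⟨z, hz, rfl⟩ | hz) | hz) | hz) | ⟨z, hz, rfl⟩)
    · exact hN₁ z hz
    · exact hlegC b hba hbc' z hz
    · rcases hz with rfl | rfl | hz
      · exact hlegC b hba hbc' _ (hend b)
      · exact hlegC d hda hdc _ (hend d)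
      · exact hGC z hz
    · exact hlegC d hda hdc z hz
    · exact hN₂ z hz
  -- a point on the leg of `a`
  have hn : 0 < ‖u a‖ := norm_pos_iff.2 (hu a)
  set σ : ℝ := R / 2 / ‖u a‖ with hσ
  have hσ0 : 0 < σ := by positivity
  have hσu : σ * ‖u a‖ = R / 2 := by rw [hσ]; field_simp
  obtain ⟨hσℓ, hσφ⟩ := hnear a σ hσ0.le (by rw [hσu]; linarith)
  set m : ℂ := p + σ * u a with hm
  obtain ⟨g, hg, hg₁, hg₂⟩ : ∃ g > 0, g ≤ arg (u c) - arg (u a) ∧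
      g ≤ arg (u a) + 2 * Real.pi - arg (u c) :=
    ⟨min (arg (u c) - arg (u a)) (arg (u a) + 2 * Real.pi - arg (u c)),
      lt_min (by linarith) (by linarith [lo a, hi c]), min_le_left _ _, min_le_right _ _⟩
  -- `δ` bounds the tangent of the angular deviation from the ray of `a`. It is small enough for the
  -- cross-segment at `m` to stay in the two sectors, and `δ ≤ 1` keeps the distance from `p` at
  -- most `√2 * R / 2 < R`.
  obtain ⟨δ, hδ, hδ1, hδg⟩ : ∃ δ > 0, δ ≤ 1 ∧ ∀ x, |x| ≤ δ → |Real.arctan x| < g := by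
    have := Metric.continuousAt_iff.1 (Real.continuous_arctan.continuousAt (x := 0)) g hg
    obtain ⟨δ, hδ, h⟩ := this
    refine ⟨min (δ / 2) 1, by positivity, min_le_right _ _, fun x hx => ?_⟩
    have := @h x (by rw [Real.dist_eq, sub_zero]; linarith [min_le_left (δ / 2) 1])
    simpa using this
  have hside : ∀ s : ℝ, |s| ≤ 1 → ∃ ρ : ℝ, 0 < ρ ∧ ρ < R ∧ |Real.arctan (s * δ)| < g ∧
      m + s * (I * ((δ * σ : ℝ) * u a)) =
        p + ρ * exp ((arg (u a) + Real.arctan (s * δ) : ℝ) * I) := by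
    intro s hs
    have hsδ : |s * δ| ≤ δ := by
      rw [abs_mul, abs_of_pos hδ]; exact mul_le_of_le_one_left hδ.le hs
    refine ⟨R / 2 * Real.sqrt (1 + (s * δ) ^ 2), by positivity, ?_, hδg _ hsδ, ?_⟩
    · have h1 : (s * δ) ^ 2 ≤ 1 := by
        rw [← sq_abs]; exact pow_le_one₀ (abs_nonneg _) (hsδ.trans hδ1)
      have : Real.sqrt (1 + (s * δ) ^ 2) < 2 := by
        rw [Real.sqrt_lt' two_pos]; linarith
      nlinarith
    · have e := one_add_mul_I_eq (s * δ)
      have e2 := smul_eq_mul_exp σ (u a)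
      rw [hσu] at e2
      have : m + s * (I * ((δ * σ : ℝ) * u a)) = p + σ * u a * (1 + (s * δ : ℝ) * I) := by
        rw [hm]; push_cast; ring
      rw [this, e2, e, ofReal_add, add_mul, Complex.exp_add]
      push_cast; ring
  have hside₁ : ∀ s : ℝ, 0 < s → s ≤ 1 → m + s * (I * ((δ * σ : ℝ) * u a)) ∈ N₁ := by
    intro s hs hs1
    obtain ⟨ρ, h1, h2, h3, e⟩ := hside s (by rwa [abs_of_pos hs])
    have h4 : 0 < Real.arctan (s * δ) := Real.arctan_pos.2 (by positivity)
    have h5 := (abs_lt.1 h3).2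
    rw [e]
    exact ⟨_, mul_exp_mem_sector h1 h2 (by linarith) (by linarith), rfl⟩
  have hside₂ : ∀ s : ℝ, s < 0 → -1 ≤ s → m + s * (I * ((δ * σ : ℝ) * u a)) ∈ N₂ := by
    intro s hs hs1
    obtain ⟨ρ, h1, h2, h3, e⟩ := hside s (by rw [abs_of_neg hs]; linarith)
    have h4 : Real.arctan (s * δ) < 0 :=
      Real.arctan_lt_zero.2 (mul_neg_of_neg_of_pos hs hδ)
    have h5 := (abs_lt.1 h3).1
    have e' : exp ((arg (u a) + Real.arctan (s * δ) : ℝ) * I) =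
        exp ((arg (u a) + Real.arctan (s * δ) + 2 * Real.pi : ℝ) * I) := by
      refine exp_eq_exp_iff_exists_int.2 ⟨-1, ?_⟩
      push_cast; ring
    rw [e, e']
    exact ⟨_, mul_exp_mem_sector h1 h2 (by linarith) (by linarith), rfl⟩
  have hmz : ‖(σ : ℂ) * u a‖ < R := by
    rw [norm_mul, norm_real, Real.norm_of_nonneg hσ0.le, hσu]; linarith
  have hmleg : m ∈ φ a '' Ioc 0 (ℓ a) := ⟨σ, ⟨hσ0, hσℓ.le⟩, hσφ⟩
  -- Removing `m` cuts the leg of `a` in two, but its pieces remain joined the other way round,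
  -- through the leg of `c` and `A`.
  have hCm : IsPreconnected (C \ {m}) := by
    have hac : a ≠ c := ne (hab.trans hbc)
    have hE : C \ {m} = φ a '' Ico 0 σ ∪ φ c '' Icc 0 (ℓ c) ∪ (A ∪ φ a '' Ioc σ (ℓ a)) := by
      ext z
      constructor
      · rintro ⟨(⟨t, ht, rfl⟩ | hz) | hz, hzm⟩
        · rcases lt_trichotomy t σ with h1 | rfl | h1
          · exact .inl (.inl ⟨t, ⟨ht.1, h1⟩, rfl⟩)
          · exact absurd hσφ hzm
          · exact .inr (.inr ⟨t, ⟨h1, ht.2⟩, rfl⟩)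
        · exact .inl (.inr hz)
        · exact .inr (.inl hz)
      · have hσI : σ ∈ Icc 0 (ℓ a) := ⟨hσ0.le, hσℓ.le⟩
        rintro ((⟨t, ht, rfl⟩ | ⟨t, ht, rfl⟩) | (hz | ⟨t, ht, rfl⟩))
        · have htI : t ∈ Icc 0 (ℓ a) := ⟨ht.1, (ht.2.trans hσℓ).le⟩
          exact ⟨.inl (.inl ⟨t, htI, rfl⟩), fun e =>
            ht.2.ne ((leg a).inj htI hσI (Eq.trans e hσφ.symm))⟩
        · refine ⟨.inl (.inr ⟨t, ht, rfl⟩), fun e => ?_⟩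
          rcases ht.1.eq_or_lt with rfl | h1
          · rw [(leg c).start] at e
            exact (leg a).start_notMem (by rw [mem_singleton_iff.1 e]; exact hmleg)
          · exact disj hac hmleg ⟨t, ⟨h1, ht.2⟩, e⟩
        · refine ⟨.inr hz, fun e => ?_⟩
          rw [mem_singleton_iff.1 e] at hz
          exact hA (Metric.ball_subset_ball hR₀ (by simpa [hm] using hmz)) hz
        · have htI : t ∈ Icc 0 (ℓ a) := ⟨(hσ0.trans ht.1).le, ht.2⟩
          exact ⟨.inl (.inl ⟨t, htI, rfl⟩), fun e =>
            ht.1.ne' ((leg a).inj htI hσI (Eq.trans e hσφ.symm))⟩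
    rw [hE]
    refine IsPreconnected.union (pos c) (.inr ⟨ℓ c, ⟨(leg c).pos.le, le_rfl⟩, (leg c).finish⟩)
      (.inl hcA) ?_ ?_
    · refine IsPreconnected.union p ⟨0, ⟨le_rfl, hσ0⟩, (leg a).start⟩
        ⟨0, ⟨le_rfl, (leg c).pos.le⟩, (leg c).start⟩ ?_ ?_
      · exact isPreconnected_Ico.image _ ((leg a).cont.mono fun t ht => ⟨ht.1, (ht.2.trans hσℓ).le⟩)
      · exact isPreconnected_Icc.image _ (leg c).cont
    · refine IsPreconnected.union (pos a) haA ⟨ℓ a, ⟨hσℓ, le_rfl⟩, (leg a).finish⟩ hAp ?_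
      exact isPreconnected_Ioc.image _ ((leg a).cont.mono fun t ht => ⟨(hσ0.trans ht.1).le, ht.2⟩)
  refine not_isPreconnected_of_opposite_sides (u := (δ * σ : ℝ) * u a) hCcl hDp hCD
    (mul_ne_zero (by exact_mod_cast (mul_pos hδ hσ0).ne') (hu a)) hCm one_pos ?_ ?_
    (.inl (.inl (.inl (.inl (by simpa using hside₁ 1 one_pos le_rfl)))))
    (.inr (by simpa [sub_eq_add_neg] using hside₂ (-1) (by norm_num) le_rfl))
  · intro t ht
    have ht' := abs_lt.1 ht
    have hlow : -1 ≤ t * δ := by nlinarith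
    have hupp : t * δ < 1 := by nlinarith
    have := hnear a (σ * (1 + t * δ)) (mul_nonneg hσ0.le (by linarith)) (by
      rw [mul_right_comm, hσu]; nlinarith)
    refine .inl (.inl ⟨σ * (1 + t * δ), ⟨mul_nonneg hσ0.le (by linarith), this.1.le⟩, ?_⟩)
    rw [this.2, hm]
    push_cast; ring
  · intro s hs hsC
    have hs' := abs_le.1 hs
    rcases lt_trichotomy s 0 with h1 | h1 | h1
    · exact absurd hsC (Set.disjoint_right.1 hCD (.inr (hside₂ s h1 hs'.1)))
    · exact h1
    · exact absurd hsC (Set.disjoint_right.1 hCD (.inl (.inl (.inl (.inl (hside₁ s h1 hs'.2))))))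

/-- The points from which a connected open set `O` is accessible have a linear order in which no
two disjoint connected sets off `O` cross. -/
theorem exists_noncrossing_order {V : Type*} [Finite V] {pos : V → ℂ} {O : Set ℂ}
    (hinj : Function.Injective pos) (hO : IsOpen O) (hOc : IsConnected O) (hpos : ∀ v, pos v ∉ O)
    (hacc : ∀ v, AccessibleFrom O (pos v)) :
    ∃ ang : V → ℝ, Function.Injective ang ∧ ∀ F G : Set ℂ, IsOpen F → IsPreconnected F →
      IsPreconnected G → Disjoint F O → Disjoint G O → Disjoint F G → (∀ v, pos v ∉ F) →
      (∀ v, pos v ∉ G) → ∀ a b c d, ang a < ang b → ang b < ang c → ang c < ang d →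
      AccessibleFrom F (pos a) → AccessibleFrom F (pos c) → pos b ∈ closure G →
      pos d ∉ closure G := by
  obtain ⟨p, hp⟩ := hOc.nonempty
  obtain ⟨φ, ℓ, h⟩ := exists_isStar hinj hO hOc.isPreconnected hp hpos hacc
  have leg := fun v => h.leg v (mem_univ v)
  choose u hu r hr hdir using fun v => (leg v).ray_at_start
  refine ⟨fun v => arg (u v), fun v w e => ?_, ?_⟩
  -- Two legs with the same initial direction would share the point at distance `ρ` from `p`.
  · by_contra hvw
    have hv : 0 < ‖u v‖ := norm_pos_iff.2 (hu v)
    have hw : 0 < ‖u w‖ := norm_pos_iff.2 (hu w)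
    set ρ := min (r v) (r w) / 2 with hρ
    have hm : 0 < min (r v) (r w) := lt_min (hr v) (hr w)
    have h1 := (hdir v).1 (ρ / ‖u v‖) (by positivity) (by
      rw [div_mul_cancel₀ _ hv.ne']; linarith [min_le_left (r v) (r w)])
    have h2 := (hdir w).1 (ρ / ‖u w‖) (by positivity) (by
      rw [div_mul_cancel₀ _ hw.ne']; linarith [min_le_right (r v) (r w)])
    refine (h.disj v (mem_univ v) w (mem_univ w) hvw).le_bot
      ⟨⟨ρ / ‖u v‖, ⟨by positivity, h1.1.le⟩, rfl⟩, ρ / ‖u w‖, ⟨by positivity, h2.1.le⟩, ?_⟩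
    rw [h1.2, h2.2, (leg v).start, (leg w).start, smul_eq_mul_exp, smul_eq_mul_exp _ (u v),
      div_mul_cancel₀ _ hv.ne', div_mul_cancel₀ _ hw.ne']
    simp only at e
    rw [e]
  · intro F G hF hFc hGc hFO hGO hFG hFpos hGpos a b c d hab hbc hcd ha hc hb hd
    exact h.not_crossing hp hpos hu hr hdir hF hFc hGc hFO hGO hFG hFpos hGpos hab hbc hcd
      ha hc hb hd

end ComplexPlane

open Topology Filter Set

/-! ### Noncrossing families of sets -/

/-- For a noncrossing family of subsets of a finite linear arrangement, there is a depth function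
that is larger at a point enclosed by a set of the family than on this set. -/
theorem exists_depth {V : Type*} [Finite V] {ang : V → ℝ} (hang : Function.Injective ang)
    {S : Set (Set V)} (hS : ∀ s ∈ S, ∀ t ∈ S, s ≠ t → ∀ a b c d, ang a < ang b → ang b < ang c →
      ang c < ang d → a ∈ s → c ∈ s → b ∈ t → d ∉ t) :
    ∃ depth : V → ℝ, ∀ s ∈ S, ∀ v ∉ s, (∃ x ∈ s, ang x < ang v) → (∃ y ∈ s, ang v < ang y) →
      ∀ w ∈ s, depth w < depth v := by
  set E : V → Set (Set V) := fun v =>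
    {s ∈ S | v ∉ s ∧ (∃ x ∈ s, ang x < ang v) ∧ ∃ y ∈ s, ang v < ang y} with hE
  refine ⟨fun v => (E v).ncard, ?_⟩
  rintro s hs v hvs ⟨x, hx, hxv⟩ ⟨y, hy, hvy⟩ w hw
  have hwE : s ∉ E w := fun h => h.2.1 hw
  have hvE : s ∈ E v := ⟨hs, hvs, ⟨x, hx, hxv⟩, y, hy, hvy⟩
  refine Nat.cast_lt.2 (Set.ncard_lt_ncard (Set.ssubset_iff_exists.2 ⟨?_, s, hvE, hwE⟩)
    (Set.toFinite _))
  -- A set `t` enclosing `w ∈ s` must also enclose `v` and miss it, for otherwise `s` and `t` would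
  -- cross. The inclusion is strict because `s` encloses `v` but contains `w`.
  rintro t ⟨ht, hwt, ⟨c, hc, hcw⟩, d, hd, hwd⟩
  have hst : s ≠ t := by rintro rfl; exact hwt hw
  have hvw : ang v ≠ ang w := fun e => hvs (hang e ▸ hw)
  rcases hvw.lt_or_gt with hlt | hlt
  · have hvt : v ∉ t := fun hvt => hS s hs t ht hst x v w d hxv hlt hwd hx hw hvt hd
    refine ⟨ht, hvt, ⟨c, hc, ?_⟩, d, hd, hlt.trans hwd⟩
    by_contra hcv
    have hcv' : ang v < ang c := lt_of_le_of_ne (not_lt.1 hcv) fun e => hvt (hang e ▸ hc)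
    exact hS s hs t ht hst x c w d (hxv.trans hcv') hcw hwd hx hw hc hd
  · have hvt : v ∉ t := fun hvt => hS t ht s hs hst.symm c w v y hcw hlt hvy hc hvt hw hy
    refine ⟨ht, hvt, ⟨c, hc, hcw.trans hlt⟩, d, hd, ?_⟩
    by_contra hdv
    have hdv' : ang d < ang v := lt_of_le_of_ne (not_lt.1 hdv) fun e => hvt (hang e ▸ hd)
    exact hS t ht s hs hst.symm c w d y hcw hwd (hdv'.trans hvy) hc hd hw hy

/-- `a` is the maximum of `b` on `S`, with `-K` as the default for empty `S`; this can occur, as a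
face need not have a vertex on its boundary. -/
theorem exists_threshold {V : Type*} [Finite V] {b : V → ℝ} {K : ℝ} (hK : ∀ v, |b v| < K)
    (hK₀ : 0 < K) (S : Set V) : ∃ a ∈ Ico (-K) K, (∀ v ∈ S, b v ≤ a) ∧
      ∀ v, (∀ w ∈ S, b w < b v) → a < b v := by
  rcases S.eq_empty_or_nonempty with rfl | hS
  · exact ⟨-K, ⟨le_rfl, by linarith⟩, by simp, fun v _ => (abs_lt.1 (hK v)).1⟩
  · obtain ⟨w, hw, hmax⟩ := S.toFinite.exists_maximalFor b S hS
    exact ⟨b w, ⟨(abs_lt.1 (hK w)).1.le, (abs_lt.1 (hK w)).2⟩,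
      fun v hv => (le_total (b v) (b w)).elim id fun h => hmax hv h, fun v hv => hv w hw⟩

/-! ### Plane maps -/

/-- A segment is locally a cone with apex `a`: if the way from `a` to a nearby `z` meets the segment
after `a`, then `z` lies on its line and is too close to `a` to have passed an end. -/
theorem eventually_mem_segment (a x y : Plane) : ∀ᶠ z in 𝓝 a, ∀ t ∈ Ioc (0 : ℝ) 1,
    a + t • (z - a) ∈ segment ℝ x y → z ∈ segment ℝ x y := by
  have hcl : IsClosed (segment ℝ x y) := by
    rw [segment_eq_image_lineMap]; exact (isCompact_Icc.image (by fun_prop)).isClosed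
  by_cases ha : a ∈ segment ℝ x y
  swap
  · obtain ⟨r, hr, hb⟩ := Metric.isOpen_iff.1 hcl.isOpen_compl a ha
    filter_upwards [Metric.ball_mem_nhds a hr] with z hz t ht hm
    refine absurd hm (hb ?_)
    have := (convex_ball a r).segment_subset (Metric.mem_ball_self hr) hz
    rw [segment_eq_image'] at this
    exact this ⟨t, ⟨ht.1.le, ht.2⟩, rfl⟩
  rw [segment_eq_image'] at ha ⊢
  obtain ⟨τ, hτ, rfl⟩ := ha
  by_cases hxy : y - x = 0
  · simp only [hxy, smul_zero, add_zero]
    filter_upwards with z t ht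
    rintro ⟨s, hs, e⟩
    rw [left_eq_add, smul_eq_zero, or_iff_right ht.1.ne', sub_eq_zero] at e
    exact ⟨s, hs, e.symm⟩
  have hn : 0 < ‖y - x‖ := norm_pos_iff.2 hxy
  -- No bound is imposed when `c = 0`: then `a` is the end in question and the segment contains no
  -- points beyond it.
  have near : ∀ c : ℝ, 0 ≤ c → ∀ᶠ z in 𝓝 (x + τ • (y - x)), c ≠ 0 →
      ‖z - (x + τ • (y - x))‖ < c * ‖y - x‖ := by
    intro c hc
    rcases hc.eq_or_lt with rfl | hc
    · simp
    · filter_upwards [Metric.ball_mem_nhds _ (mul_pos hc hn)] with z hz _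
      rwa [← dist_eq_norm]
  filter_upwards [near τ hτ.1, near (1 - τ) (by linarith [hτ.2])] with z h1 h2 t ht
  rintro ⟨s, hs, e⟩
  have hz : z = x + τ • (y - x) + ((s - τ) / t) • (y - x) := by
    have e' : t • (z - (x + τ • (y - x))) = (s - τ) • (y - x) := by
      rw [sub_smul, eq_sub_iff_add_eq, ← add_right_inj x]
      refine Eq.trans ?_ e.symm
      abel
    rw [div_eq_inv_mul, mul_smul, ← e', smul_smul, inv_mul_cancel₀ ht.1.ne', one_smul]
    abel
  have hnorm : ‖z - (x + τ • (y - x))‖ = |(s - τ) / t| * ‖y - x‖ := by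
    rw [hz, add_sub_cancel_left, norm_smul, Real.norm_eq_abs]
  rw [hnorm] at h1 h2
  refine ⟨τ + (s - τ) / t, ?_, by simp only [hz, add_smul]; abel⟩
  rcases lt_trichotomy s τ with hlt | rfl | hlt
  · have h3 := lt_of_mul_lt_mul_right (h1 (by linarith [hs.1])) hn.le
    have h4 : (s - τ) / t < 0 := div_neg_of_neg_of_pos (by linarith) ht.1
    rw [abs_of_neg h4] at h3
    exact ⟨by linarith, by linarith [hτ.2]⟩
  · simpa using hτ
  · have h3 := lt_of_mul_lt_mul_right (h2 (by linarith [hs.2])) hn.le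
    have h4 : 0 < (s - τ) / t := div_pos (by linarith) ht.1
    rw [abs_of_pos h4] at h3
    exact ⟨by linarith [hτ.1], by linarith⟩

namespace PlaneMap

variable {V E : Type*} (M : PlaneMap V E)

theorem isClosed_support [Finite V] [Finite E] : IsClosed M.support := by
  refine (Set.finite_range _).isClosed.union (isClosed_iUnion_of_finite fun e => ?_)
  refine (Set.finite_Iio (M.curve e).len).isClosed_biUnion fun i _ => ?_
  rw [segment_eq_image_lineMap]
  exact (isCompact_Icc.image (by fun_prop)).isClosed

theorem eventually_segment_subset_compl [Finite V] [Finite E] (a : Plane) :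
    ∀ᶠ z in 𝓝 a, z ∈ M.supportᶜ → ∀ t ∈ Ioc (0 : ℝ) 1, a + t • (z - a) ∈ M.supportᶜ := by
  -- Vertices are treated as degenerate segments; isolated vertices lie on no edge.
  have h1 : ∀ᶠ z in 𝓝 a, ∀ v, ∀ t ∈ Ioc (0 : ℝ) 1,
      a + t • (z - a) ∈ segment ℝ (M.pos v) (M.pos v) → z ∈ segment ℝ (M.pos v) (M.pos v) :=
    eventually_all.2 fun v => eventually_mem_segment a _ _
  have h2 : ∀ᶠ z in 𝓝 a, ∀ e, ∀ i ∈ Set.Iio (M.curve e).len, ∀ t ∈ Ioc (0 : ℝ) 1,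
      a + t • (z - a) ∈ segment ℝ ((M.curve e).pt i) ((M.curve e).pt (i + 1)) →
      z ∈ segment ℝ ((M.curve e).pt i) ((M.curve e).pt (i + 1)) :=
    eventually_all.2 fun e => (eventually_all_finite (Set.finite_Iio _)).2 fun i _ =>
      eventually_mem_segment a _ _
  filter_upwards [h1, h2] with z hz1 hz2 hz t ht hm
  refine hz ?_
  rcases hm with ⟨v, hv⟩ | hm
  · have := hz1 v t ht (by rw [← hv, segment_same]; rfl)
    rw [segment_same] at this
    exact .inl ⟨v, this.symm⟩
  · simp only [PolygonalCurve.carrier, mem_iUnion] at hm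
    obtain ⟨e, i, hi, hm⟩ := hm
    refine .inr (mem_iUnion.2 ⟨e, ?_⟩)
    exact mem_iUnion₂.2 ⟨i, hi, hz2 e i hi t ht hm⟩

variable {M}

theorem Face.isOpen [Finite V] [Finite E] (F : M.Face) : IsOpen F.1 := by
  obtain ⟨_, x, _, rfl⟩ := F
  exact M.isClosed_support.isOpen_compl.connectedComponentIn

theorem Face.isConnected (F : M.Face) : IsConnected F.1 := by
  obtain ⟨_, x, hx, rfl⟩ := F
  exact ⟨⟨x, mem_connectedComponentIn hx⟩, isPreconnected_connectedComponentIn⟩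

theorem Face.pos_notMem (F : M.Face) (v : V) : M.pos v ∉ F.1 := by
  obtain ⟨_, x, _, rfl⟩ := F
  exact fun h => connectedComponentIn_subset _ _ h (.inl ⟨v, rfl⟩)

theorem Face.disjoint {F G : M.Face} (h : F ≠ G) : Disjoint F.1 G.1 := by
  rw [Set.disjoint_left]
  intro z hF hG
  refine h (Subtype.ext ?_)
  obtain ⟨_, x, _, rfl⟩ := F
  obtain ⟨_, y, _, rfl⟩ := G
  exact (connectedComponentIn_eq hF).trans (connectedComponentIn_eq hG).symm

theorem Incident.accessibleFrom [Finite V] [Finite E] {v : V} {F : M.Face} (h : M.Incident v F) :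
    AccessibleFrom F.1 (M.pos v) := by
  obtain ⟨_, x, _, rfl⟩ := F
  exact accessibleFrom_connectedComponentIn (M.eventually_segment_subset_compl _) h

/-- The vertices on a face `O` have a linear order in which no two other faces cross. -/
theorem exists_noncrossing_order [Finite V] [Finite E] {O : M.Face} (hO : ∀ v, M.Incident v O) :
    ∃ ang : V → ℝ, Function.Injective ang ∧ ∀ F G : M.Face, F ≠ O → G ≠ O → F ≠ G → ∀ a b c d,
      ang a < ang b → ang b < ang c → ang c < ang d → M.Incident a F → M.Incident c F →
      M.Incident b G → ¬ M.Incident d G := by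
  -- The faces are moved to `ℂ`, where arguments and logarithms are available; incidence and
  -- straight segments are preserved.
  set T : Plane ≃L[ℝ] ℂ := Complex.equivRealProdCLM.symm with hT
  have hacc : ∀ {v} {F : M.Face}, M.Incident v F → AccessibleFrom (T '' F.1) (T (M.pos v)) := by
    intro v F h
    obtain ⟨q, hq⟩ := h.accessibleFrom
    exact ⟨T q, fun t ht => ⟨_, hq t ht, by simp⟩⟩
  have hopen : ∀ F : M.Face, IsOpen (T '' F.1) := fun F =>
    T.toHomeomorph.isOpenMap _ F.isOpen
  have hconn : ∀ F : M.Face, IsConnected (T '' F.1) := fun F =>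
    F.isConnected.image _ T.continuous.continuousOn
  have hdisj : ∀ {F G : M.Face}, F ≠ G → Disjoint (T '' F.1) (T '' G.1) := fun h =>
    (disjoint_image_iff T.injective).2 (Face.disjoint h)
  have hpos : ∀ (F : M.Face) v, T (M.pos v) ∉ T '' F.1 := fun F v h =>
    F.pos_notMem v (T.injective.mem_set_image.1 h)
  have hcl : ∀ {v} {F : M.Face}, M.Incident v F → T (M.pos v) ∈ closure (T '' F.1) := fun h =>
    image_closure_subset_closure_image T.continuous ⟨_, h, rfl⟩
  obtain ⟨ang, hang, h⟩ := _root_.exists_noncrossing_order (T.injective.comp M.pos_injective)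
    (hopen O) (hconn O) (hpos O) (fun v => hacc (hO v))
  refine ⟨ang, hang, fun F G hF hG hFG a b c d hab hbc hcd ha hc hb hd => ?_⟩
  exact h _ _ (hopen F) (hconn F).isPreconnected (hconn G).isPreconnected (hdisj hF) (hdisj hG)
    (hdisj hFG) (hpos F) (hpos G) a b c d hab hbc hcd (hacc ha) (hacc hc) (hcl hb) (hcl hd)

/-- A family of `n` real functions on the vertices such that each vertex off a face exceeds the
vertices of the face in one of them yields `n` interval orders. -/
theorem isIntersectionOfIntervalOrders [Finite V] {n : ℕ} (hn : 0 < n) (b : Fin n → V → ℝ)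
    (hb : ∀ v (F : M.Face), ¬ M.Incident v F → ∃ i, ∀ w, M.Incident w F → b i w < b i v) :
    IsIntersectionOfIntervalOrders M.VertexFace n := by
  obtain ⟨K, hK₀, hK⟩ : ∃ K : ℝ, 0 < K ∧ ∀ i v, |b i v| < K := by
    obtain ⟨K, hK⟩ := (Set.finite_range fun x : Fin n × V => |b x.1 x.2|).bddAbove
    refine ⟨|K| + 1, by positivity, fun i v => ?_⟩
    linarith [hK ⟨(i, v), rfl⟩, le_abs_self K]
  choose a haK ha ha' using fun (i : Fin n) (F : M.Face) =>
    exists_threshold (hK i) hK₀ {v | M.Incident v F}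
  -- Vertices get the intervals `(-K - 1, b i v)` and faces `(a i F, K)`. No right end is as low as
  -- `-K - 1` and no left end as high as `K`, so only a vertex can precede and only a face can
  -- follow.
  let lo : Fin n → M.VertexFace → ℝ := fun i => VertexFace.rec (fun _ => -K - 1) (a i)
  let hi : Fin n → M.VertexFace → ℝ := fun i => VertexFace.rec (b i) fun _ => K
  refine ⟨fun i x y => hi i x ≤ lo i y, fun i => ⟨lo i, hi i, ?_, fun _ _ => Iff.rfl⟩, ?_⟩
  · rintro (v | F)
    · change -K - 1 < b i v
      linarith [abs_lt.1 (hK i v)]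
    · exact (haK i F).2
  · rintro (v | F) (w | G)
    · refine iff_of_false id fun h => ?_
      have : b ⟨0, hn⟩ v ≤ -K - 1 := h ⟨0, hn⟩
      linarith [abs_lt.1 (hK ⟨0, hn⟩ v)]
    · change M.Incident v G ↔ ∀ i, b i v ≤ a i G
      refine ⟨fun h i => ha i G v h, fun h => ?_⟩
      by_contra hv
      obtain ⟨i, hi⟩ := hb v G hv
      exact absurd (h i) (not_le.2 (ha' i G v hi))
    · refine iff_of_false id fun h => ?_
      have : K ≤ -K - 1 := h ⟨0, hn⟩
      linarith
    · refine iff_of_false id fun h => ?_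
      have : K ≤ a ⟨0, hn⟩ G := h ⟨0, hn⟩
      linarith [(haK ⟨0, hn⟩ G).2]

end PlaneMap

/-! ### The bound from position, negated position and depth -/

theorem mainTheorem3 {V E : Type*} [Finite V] [Finite E] (M : PlaneMap V E)
    (hM : M.IsOuterplanar) : intervalDimension M.VertexFace ≤ 3 := by
  obtain ⟨O, -, hO⟩ := hM
  obtain ⟨ang, hang, hcross⟩ := PlaneMap.exists_noncrossing_order hO
  obtain ⟨depth, hdepth⟩ := exists_depth hang
    (S := {s | ∃ F : M.Face, F ≠ O ∧ s = {v | M.Incident v F}}) (by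
      rintro _ ⟨F, hF, rfl⟩ _ ⟨G, hG, rfl⟩ hne a b c d hab hbc hcd ha hc hb
      exact hcross F G hF hG (fun e => hne (by rw [e])) a b c d hab hbc hcd ha hc hb)
  refine iInf₂_le 3 (PlaneMap.isIntersectionOfIntervalOrders three_pos
    ![ang, fun v => -ang v, depth] fun v F hv => ?_)
  -- Either `v` lies beyond all vertices of `F` on one side, or it is enclosed by `F`. In the
  -- enclosed case the depth applies, since `F ≠ O`: the vertex `v` is on `O` but not on `F`.
  by_cases h0 : ∀ w, M.Incident w F → ang w < ang v
  · exact ⟨0, h0⟩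
  by_cases h1 : ∀ w, M.Incident w F → -ang w < -ang v
  · exact ⟨1, h1⟩
  push Not at h0 h1
  obtain ⟨y, hy, hvy⟩ := h0
  obtain ⟨x, hx, hxv⟩ := h1
  have hne : ∀ w, M.Incident w F → ang v ≠ ang w := fun w hw e => hv (hang e ▸ hw)
  refine ⟨2, hdepth {v | M.Incident v F} ⟨F, fun e => hv (e ▸ hO v), rfl⟩ v hv
    ⟨x, hx, lt_of_le_of_ne (neg_le_neg_iff.1 hxv) (hne x hx).symm⟩
    ⟨y, hy, lt_of_le_of_ne hvy (hne y hy)⟩⟩
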